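/- Consider a Markov decision process with state space $S$, action space $A$ (equipped with a reference measure with respect to which all policies have conditional densities $\pi(a\mid s)$), transition kernel $T$, initial distribution $\mu_0$, discount factor $\gamma\in[0,1)$ and rewards with $|r(s,a)|\le R$ for all $s,a$. For a policy $\pi$ let $J(\pi)=\sum_{t\ge 0}\gamma^t\,\mathbb E_\pi[r(s_t,a_t)]$ be its expected return and $d^\pi=(1-\gamma)\sum_{t\ge0}\gamma^t\,\mathbb P_\pi(s_t\in\cdot)$ its discounted state-visitation distribution. Let $\pi_b$ be a behavior policy for which $\log\pi_b(a\mid s)$ is integrable under $s\sim d^{\pi_b},\,a\sim\pi_b(\cdot\mid s)$, and write $\mathbb E_{\pi_b}$ for the expectation over such pairs $(s,a)$. Let $\mathcal D=\{(s_i,a_i,r(s_i,a_i),s_i')\}_{i=1}^n$, $n\ge 1$, consist of independent samples $s_i\sim d^{\pi_b}$, $a_i\sim\pi_b(\cdot\mid s_i)$, $s_i'\sim T(\cdot\mid s_i,a_i)$. Let $\Pi=\{\pi_\phi\}$ be a class of policies (containing a countable subset that is sequentially dense for pointwise convergence of the densities) such that $\pi_\phi(a\mid s)>0$ and $|\log\pi_\phi(a\mid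 s)|<L$ for all $\phi,s,a$, and such that the class of functions $(s,a)\mapsto\log\pi_\phi(a\mid s)$ has VC dimension at most $V$ in Vapnik's sense, i.e. the sets $\{(s,a):\log\pi_\phi(a\mid s)\ge\beta\}$, $\phi$ and $\beta\in\mathbb R$ arbitrary, have VC dimension at most $V$. Fix $M$ Q-networks $Q_{\theta_1},\dots,Q_{\theta_M}$ (measurable in $(s,a)$) with target copies $Q_{\theta_j'}$ (initially $\theta_j'=\theta_j$), and write $\overline Q_\theta=\nu\min_jQ_{\theta_j}+(1-\nu)\max_jQ_{\theta_j}$, $\nu\in[0,1]$. Let $\lambda>0$, $\eta\ge0$, $\tau\in[0,1]$. Let $\pi_\phi$ be the policy returned after $T\ge1$ iterations of CDC, where each iteration performs the following steps exactly: (i) for a batch $\mathcal B$ from $\mathcal D$ and $N\ge 1$ actions $\hat a_k$, respectively $a_k'$, sampled at each state $s$, respectively $s'$, of the batch, each $\theta_j$ is replaced by a minimizer of $\sum_{\mathcal B}\big[(Q_{\theta_j}(s,a)-r-\gamma\max_k\overline Q_{\theta'}(s',a_k'))^2+\eta\,\big(\max_kQ_{\theta_j}(s,\hat a_k)-Q_{\theta_j}(s,a)\big)_+^2\big]$;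 (ii) $\phi$ is replaced by a maximizer, over the whole class and with the full dataset, of $\sum_{i=1}^n\big(\mathbb E_{\hat a\sim\pi_\phi(\cdot\mid s_i)}[\overline Q_\theta(s_i,\hat a)]+\lambda\log\pi_\phi(a_i\mid s_i)\big)$; (iii) $\theta_j'\leftarrow\tau\theta_j+(1-\tau)\theta_j'$. The initial weights, the batches in (i) and the sampled actions may be arbitrary, and may depend on the data. Assume that all learned Q-networks satisfy $|Q_{\theta_j}(s,a)|<B$ for all $s,a$. Then there are constants $r^*$, $C_\lambda$, independent of $n$, $\delta$ and the data, such that for every $\delta\in(0,1)$, with probability at least $1-\delta$, $$J(\pi_\phi)\ \ge\ J(\pi_b)-\frac{r^*}{(1-\gamma)^2}\sqrt{C_\lambda+\sqrt{\frac{V-\log\delta}{n}}}.$$ More precisely, one can take $r^*=K\sqrt{1+L}\,R$ with a universal constant $K\ge1$, and $$C_\lambda=C_b-C_\lambda^*,\qquad C_b=\mathbb E_{\pi_b}[\log\pi_b(a\mid s)],\qquad C^*_\lambda=\sup_{\pi\in\Pi}\mathbb E_{\pi_b}[\log\pi(a\mid s)]-\frac{2B}{\lambda},$$ and $C_\lambda$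 is nonnegative and strictly decreasing in $\lambda>0$. On the same event the inequality also holds with $C_\lambda$ replaced by $\max\{0,\,C_b-\widehat C\}$, where $\widehat C=\frac1n\sum_{i=1}^n\log\pi_\phi(a_i\mid s_i)$ is the level of empirical log-likelihood reached by the last policy update. -/

import Mathlib

open MeasureTheory ProbabilityTheory Set Filter Topology
open scoped ENNReal

namespace CDC

/-- A discounted, infinite-horizon Markov decision process with reward `r(s, a)`. -/
structure MDP (S A : Type*) [MeasurableSpace S] [MeasurableSpace A] where
  /-- transition probabilities -/
  trans : Kernel (S × A) S
  markov : IsMarkovKernel trans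
  /-- instantaneous reward -/
  reward : S → A → ℝ
  measurable_reward : Measurable (Function.uncurry reward)
  /-- initial state distribution -/
  init : Measure S
  prob_init : IsProbabilityMeasure init
  /-- discount factor -/
  γ : ℝ
  γ_nonneg : 0 ≤ γ
  γ_lt_one : γ < 1

/-- A stochastic policy given by its conditional density `π(a | s)` with respect to a reference
measure on the actions (Lebesgue measure when the action space is a subset of `ℝ^d`). -/
structure Policy (S : Type*) {A : Type*} [MeasurableSpace S] [MeasurableSpace A]
    (ref : Measure A) where
  dens : S → A → ℝ
  measurable_dens : Measurable (Function.uncurry dens)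
  dens_nonneg : ∀ s a, 0 ≤ dens s a
  lintegral_dens : ∀ s, ∫⁻ a, ENNReal.ofReal (dens s a) ∂ref = 1

section RL

variable {S A : Type*} [MeasurableSpace S] [MeasurableSpace A] {ref : Measure A} [SFinite ref]

/-- The Markov kernel `s ↦ π(· | s)` of a policy. -/
noncomputable def Policy.kernel (p : Policy S ref) : Kernel S A :=
  Kernel.withDensity (Kernel.const S ref) (fun s a => ENNReal.ofReal (p.dens s a))

theorem Policy.kernel_apply (p : Policy S ref) (s : S) :
    p.kernel s = ref.withDensity (fun a => ENNReal.ofReal (p.dens s a)) := by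
  have h : Measurable (Function.uncurry fun (s : S) (a : A) => ENNReal.ofReal (p.dens s a)) :=
    p.measurable_dens.ennreal_ofReal
  rw [Policy.kernel, Kernel.withDensity_apply _ h, Kernel.const_apply]

instance (p : Policy S ref) : IsMarkovKernel p.kernel :=
  ⟨fun s => ⟨by
    rw [p.kernel_apply, withDensity_apply _ MeasurableSet.univ, Measure.restrict_univ]
    exact p.lintegral_dens s⟩⟩

/-- The law of the state `s_t` when acting with `p` from the initial distribution. -/
noncomputable def stateLaw (m : MDP S A) (p : Policy S ref) : ℕ → Measure S
  | 0 => m.init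
  | t + 1 => m.trans ∘ₘ (stateLaw m p t ⊗ₘ p.kernel)

/-- The expected discounted return `J(π) = ∑ₜ γ^t E[r(s_t, a_t)]`. -/
noncomputable def expReturn (m : MDP S A) (p : Policy S ref) : ℝ :=
  ∑' t : ℕ, m.γ ^ t * ∫ x, m.reward x.1 x.2 ∂(stateLaw m p t ⊗ₘ p.kernel)

/-- The (normalized, discounted) state-visitation distribution `d^π = (1 - γ) ∑ₜ γ^t P(s_t ∈ ·)`. -/
noncomputable def visitation (m : MDP S A) (p : Policy S ref) : Measure S :=
  Measure.sum fun t : ℕ => ENNReal.ofReal ((1 - m.γ) * m.γ ^ t) • stateLaw m p t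

/-- The joint law of `(s, a)` with `s ∼ d^π` and `a ∼ π(· | s)`. -/
noncomputable def stateActionLaw (m : MDP S A) (p : Policy S ref) : Measure (S × A) :=
  visitation m p ⊗ₘ p.kernel

/-- The law of one transition `((s, a), s')` recorded while acting with `p`. -/
noncomputable def transitionLaw (m : MDP S A) (p : Policy S ref) : Measure ((S × A) × S) :=
  stateActionLaw m p ⊗ₘ m.trans

/-- The true expected log-likelihood `E_{(s,a) ∼ ρ}[log π(a | s)]`. -/
noncomputable def logLik (ρ : Measure (S × A)) (p : Policy S ref) : ℝ :=
  ∫ x, Real.log (p.dens x.1 x.2) ∂ρ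

/-- The empirical log-likelihood `E_{(s,a) ∼ D}[log π(a | s)]` over a dataset. -/
noncomputable def empLogLik {n : ℕ} (D : Fin n → (S × A) × S) (p : Policy S ref) : ℝ :=
  (∑ i, Real.log (p.dens (D i).1.1 (D i).1.2)) / n

/-- The level of log-likelihood secured by the penalty with weight `lam` when the Q-values are
bounded by `B`: the best level in the policy class, minus `2 B / lam`. -/
noncomputable def likLevel {Φ : Type*} (ρ : Measure (S × A)) (pol : Φ → Policy S ref)
    (B lam : ℝ) : ℝ :=
  (⨆ φ, logLik ρ (pol φ)) - 2 * B / lam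

/-- The constant `C_λ = C_b - C_λ^*`, where `C_b = E[log π_b(a | s)]` under the data law. -/
noncomputable def cLambda {Φ : Type*} (m : MDP S A) (πb : Policy S ref) (pol : Φ → Policy S ref)
    (B lam : ℝ) : ℝ :=
  logLik (stateActionLaw m πb) πb - likLevel (stateActionLaw m πb) pol B lam

end RL

section Complexity

/-- Vapnik's VC dimension of a class of real-valued functions (that is, the VC dimension of the
class of thresholded indicators `z ↦ 1{f z ≥ β}`, `f ∈ F`, `β ∈ ℝ`) is at most `V`. -/
def VCDimLE {Z : Type*} (F : Set (Z → ℝ)) (V : ℕ) : Prop :=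
  ∀ W : Finset Z, (∀ U ⊆ W, ∃ f ∈ F, ∃ β : ℝ, ∀ z ∈ W, (z ∈ U ↔ β ≤ f z)) → W.card ≤ V

variable {S A Φ : Type*} [MeasurableSpace S] [MeasurableSpace A] {ref : Measure A}

/-- The class of functions `(s, a) ↦ log π_φ(a | s)`. -/
noncomputable def logLikClass (pol : Φ → Policy S ref) : Set (S × A → ℝ) :=
  range fun φ z => Real.log ((pol φ).dens z.1 z.2)

/-- The usual measurability convention of empirical process theory: countably many members of the
class are pointwise sequentially dense in it. It holds for networks whose output depends
continuously on a weight vector in `ℝ^p`. -/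
def PointwiseSeparable (pol : Φ → Policy S ref) : Prop :=
  ∃ Φ₀ : Set Φ, Φ₀.Countable ∧ ∀ φ, ∃ u : ℕ → Φ, (∀ k, u k ∈ Φ₀) ∧
    ∀ s a, Tendsto (fun k => (pol (u k)).dens s a) atTop (𝓝 ((pol φ).dens s a))

end Complexity

section Algorithm

/-- Hyperparameters: penalty weights `lam` (policy) and `η` (value), target averaging rate `τ`,
and weight `ν` of the minimum in the Q-ensemble. -/
structure Hyper where
  lam : ℝ
  η : ℝ
  τ : ℝ
  ν : ℝ
  lam_pos : 0 < lam
  η_nonneg : 0 ≤ η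
  τ_mem : τ ∈ Icc (0 : ℝ) 1
  ν_mem : ν ∈ Icc (0 : ℝ) 1

/-- Everything that is produced while the algorithm is run on `n` transitions with `M` Q-networks
and `N` sampled actions: network weights after each iteration, and the batch (a multiset of indices
of transitions) and the sampled actions used for the value update of each iteration. -/
structure Trace (A Θ Φ : Type*) (n M N : ℕ) where
  θ : ℕ → Fin M → Θ
  θtarget : ℕ → Fin M → Θ
  φ : ℕ → Φ
  batch : ℕ → Multiset (Fin n)
  /-- actions sampled at the states `s_i` -/
  act : ℕ → Fin n → Fin N → A
  /-- actions sampled at the next states `s'_i` -/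
  actNext : ℕ → Fin n → Fin N → A

variable {S A Θ Φ : Type*} {n M N : ℕ}

/-- The ensemble value `ν minⱼ Q_{θⱼ} + (1 - ν) maxⱼ Q_{θⱼ}`. -/
noncomputable def qBar (Q : Θ → S → A → ℝ) (ν : ℝ) (θ : Fin M → Θ) (s : S) (a : A) : ℝ :=
  ν * (⨅ j, Q (θ j) s a) + (1 - ν) * ⨆ j, Q (θ j) s a

/-- The loss minimized by each Q-network: squared temporal differences with respect to the targets
`y`, plus `η` times the extra-overestimation penalty, summed over the batch. -/
noncomputable def valueLoss (Q : Θ → S → A → ℝ) (η : ℝ) (D : Fin n → (S × A) × S)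
    (batch : Multiset (Fin n)) (act : Fin n → Fin N → A) (y : Fin n → ℝ) (θ : Θ) : ℝ :=
  (batch.map fun i => (Q θ (D i).1.1 (D i).1.2 - y i) ^ 2
    + η * max ((⨆ k, Q θ (D i).1.1 (act i k)) - Q θ (D i).1.1 (D i).1.2) 0 ^ 2).sum

variable [MeasurableSpace S] [MeasurableSpace A] {ref : Measure A} [SFinite ref]

/-- The objective maximized by the policy update, over the full dataset:
`∑ᵢ (E_{â ∼ π(· | sᵢ)}[Q̄(sᵢ, â)] + lam · log π(aᵢ | sᵢ))`. -/
noncomputable def policyObjective (Qb : S → A → ℝ) (lam : ℝ) (D : Fin n → (S × A) × S)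
    (p : Policy S ref) : ℝ :=
  ∑ i, ((∫ a, Qb (D i).1.1 a ∂(p.kernel (D i).1.1))
    + lam * Real.log (p.dens (D i).1.1 (D i).1.2))

/-- `c` is a run of `T` iterations of the CDC algorithm on the dataset `D`, with exact `argmin` and
`argmax` steps and full-batch policy updates. The initial weights, the batches of the value updates
and the realized values of the sampled actions are unrestricted, so that every realization of the
algorithm's internal randomness is covered. -/
structure IsCDCRun [AddCommGroup Θ] [Module ℝ Θ] (m : MDP S A) (Q : Θ → S → A → ℝ)
    (pol : Φ → Policy S ref) (h : Hyper) (D : Fin n → (S × A) × S) (T : ℕ)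
    (c : Trace A Θ Φ n M N) : Prop where
  target_init : c.θtarget 0 = c.θ 0
  value_step : ∀ t < T, ∀ j, IsMinOn
    (valueLoss Q h.η D (c.batch t) (c.act t) fun i =>
      m.reward (D i).1.1 (D i).1.2
        + m.γ * ⨆ k, qBar Q h.ν (c.θtarget t) (D i).2 (c.actNext t i k))
    univ (c.θ (t + 1) j)
  policy_step : ∀ t < T, IsMaxOn
    (fun φ => policyObjective (qBar Q h.ν (c.θ (t + 1))) h.lam D (pol φ)) univ (c.φ (t + 1))
  target_step : ∀ t < T, ∀ j,
    c.θtarget (t + 1) j = h.τ • c.θ (t + 1) j + (1 - h.τ) • c.θtarget t j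

end Algorithm

end CDC

/-! The last policy update secures likelihood, and likelihood secures return. Since `|Q| < B`, the
value terms of two policies in the averaged policy objective differ by at most `2 * B`, so a
maximizer has empirical log-likelihood within `2 * B / lam` of every competitor
(`empLogLik_le_of_isMaxOn`). The returned policy depends on the data, so empirical and true
log-likelihoods are compared uniformly over the class (`exists_event_abs_empLogLik_sub_logLik_le`).
On that single event the whole argument is deterministic, whatever the internal randomness of the
run.

The gap of true log-likelihoods between `πb` and a policy is the Kullback-Leibler divergence of
their action laws, averaged over the visitation distribution of `πb`. A Pinsker-type inequality
(`integral_abs_sub_le_sqrt`) turns it into an L¹ distance, and a simulation argument along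
trajectories of `πb` (`abs_expReturn_sub_le`) turns that into a loss of return with factor `(1 -
γ)⁻²`.

The uniform bound has rate `√(V / n)` without a logarithm of `n`, so Sauer-Shelah with a union bound
is not enough. Dudley's packing bound (`card_le_of_separated`) gives nets whose size depends only on
the scale and `V`; chaining over them (`sum_exp_signSum_le`) bounds an exponential moment of the
Rademacher supremum over sets. Layer-cake integration passes from superlevel sets to functions,
symmetrization from signs to samples (`integral_exp_deviation_le`), and Markov's inequality yields
the tail with `log δ` directly. -/

namespace CDC

/-! ### Packing and covering numbers of VC set families. -/

section Packing

/-- A generating-function bound for the partial sums of binomial coefficients. -/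
theorem sum_choose_le (m V : ℕ) {t : ℝ} (ht : 0 < t) (ht1 : t ≤ 1) :
    (∑ k ∈ Finset.Iic V, (m.choose k : ℝ)) ≤ t⁻¹ ^ V * Real.exp (t * m) := by
  -- As `t ≤ 1`, `t ^ V ≤ t ^ k` for `k ≤ V`, so the weighted partial sum is dominated by the full
  -- binomial expansion.
  have h1 : (∑ k ∈ Finset.Iic V, (m.choose k : ℝ)) * t ^ V ≤ (t + 1) ^ m := by
    rw [add_pow, Finset.sum_mul]
    calc ∑ k ∈ Finset.Iic V, (m.choose k : ℝ) * t ^ V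
        ≤ ∑ k ∈ Finset.Iic V, t ^ k * 1 ^ (m - k) * (m.choose k : ℝ) := by
          refine Finset.sum_le_sum fun k hk => ?_
          have := pow_le_pow_of_le_one ht.le ht1 (Finset.mem_Iic.1 hk)
          rw [one_pow, mul_one, mul_comm]
          gcongr
      _ ≤ ∑ k ∈ Finset.range (m + 1), t ^ k * 1 ^ (m - k) * (m.choose k : ℝ) := by
          rw [← Finset.sum_filter_of_ne (p := fun k => k < m + 1) (s := Finset.Iic V)]
          · refine Finset.sum_le_sum_of_subset_of_nonneg ?_ fun k _ _ => by positivity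
            intro k hk
            exact Finset.mem_range.2 (Finset.mem_filter.1 hk).2
          · intro k _ hk
            by_contra hlt
            exact hk (by rw [Nat.choose_eq_zero_of_lt (by omega)]; simp)
  have h2 : (t + 1) ^ m ≤ Real.exp (t * m) := by
    rw [mul_comm, Real.exp_nat_mul]
    exact pow_le_pow_left₀ (by positivity) (Real.add_one_le_exp t) m
  rw [inv_pow, inv_mul_eq_div, le_div_iff₀ (by positivity)]
  exact h1.trans h2

variable {α β : Type*} [DecidableEq α] [Fintype β] [DecidableEq β]

/-- Pulling a set family back along a map does not increase its VC dimension. -/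
theorem vcDim_image_preimage_le (𝒜 : Finset (Finset α)) (g : β → α) :
    (𝒜.image fun A => Finset.univ.filter fun j => g j ∈ A).vcDim ≤ 𝒜.vcDim := by
  refine Finset.sup_le fun t ht => ?_
  rw [Finset.mem_shatterer] at ht
  have key : ∀ u ⊆ t, ∃ A ∈ 𝒜, ∀ j ∈ t, (g j ∈ A ↔ j ∈ u) := by
    intro u hu
    obtain ⟨v, hv, hvu⟩ := ht hu
    obtain ⟨A, hA, rfl⟩ := Finset.mem_image.1 hv
    refine ⟨A, hA, fun j hj => ?_⟩
    rw [← hvu]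
    simp [hj]
  -- Singletons must be cut out, so two shattered indices cannot share an image.
  have hinj : Set.InjOn g t := by
    intro i hi j hj hij
    obtain ⟨A, -, hA⟩ := key {i} (by simpa using hi)
    have h1 := (hA i hi).2 (by simp)
    rw [hij] at h1
    have := (hA j hj).1 h1
    exact (Finset.mem_singleton.1 this).symm
  have hsh : 𝒜.Shatters (t.image g) := by
    intro u hu
    obtain ⟨A, hA, hAu⟩ := key (t.filter fun j => g j ∈ u) (Finset.filter_subset _ _)
    refine ⟨A, hA, ?_⟩
    ext x
    simp only [Finset.mem_inter, Finset.mem_image]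
    constructor
    · rintro ⟨⟨j, hj, rfl⟩, hx⟩
      have := (hAu j hj).1 hx
      simpa [hj] using this
    · intro hx
      obtain ⟨j, hj, rfl⟩ := Finset.mem_image.1 (hu hx)
      exact ⟨⟨j, hj, rfl⟩, (hAu j hj).2 (by simp [hj, hx])⟩
  rw [← Finset.card_image_of_injOn hinj]
  exact hsh.card_le_vcDim

/-- The Sauer-Shelah bound in exponential form. -/
theorem card_le_of_vcDim_le (𝒜 : Finset (Finset β)) {V : ℕ} (hV : 𝒜.vcDim ≤ V) {t : ℝ}
    (ht : 0 < t) (ht1 : t ≤ 1) :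
    (𝒜.card : ℝ) ≤ t⁻¹ ^ V * Real.exp (t * Fintype.card β) := by
  refine le_trans ?_ (sum_choose_le (Fintype.card β) V ht ht1)
  have h1 : 𝒜.card ≤ ∑ k ∈ Finset.Iic V, (Fintype.card β).choose k :=
    (Finset.card_le_card_shatterer 𝒜).trans <| Finset.card_shatterer_le_sum_vcDim.trans <|
      Finset.sum_le_sum_of_subset (Finset.Iic_subset_Iic.2 hV)
  exact_mod_cast h1

variable [Fintype α]

/-- Sets that pairwise differ on a fixed fraction of the points are told apart by few points. -/
theorem exists_separating_sample (𝒩 : Finset (Finset α)) {ε : ℝ}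
    (hsep : ∀ A ∈ 𝒩, ∀ B ∈ 𝒩, A ≠ B → ε * Fintype.card α < ((symmDiff A B).card : ℝ))
    [Nonempty α] {m : ℕ} (hm : (𝒩.card : ℝ) ^ 2 * Real.exp (-(ε * m)) < 1) :
    ∃ g : Fin m → α, ∀ A ∈ 𝒩, ∀ B ∈ 𝒩, A ≠ B → ∃ j, g j ∈ symmDiff A B := by
  by_contra! hno
  set n := Fintype.card α
  have hn : (0 : ℝ) < n := by exact_mod_cast Fintype.card_pos
  -- Probabilistic method by counting: a sample failing for a pair has all `m` values outside the
  -- symmetric difference, which holds for at most a fraction `exp (-(ε * m))` of the samples. A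
  -- union over the pairs then cannot cover everything.
  have hcover : (Finset.univ : Finset (Fin m → α)) ⊆
      𝒩.offDiag.biUnion fun q => Fintype.piFinset fun _ => (symmDiff q.1 q.2)ᶜ := by
    intro g _
    obtain ⟨A, hA, B, hB, hAB, hg⟩ := hno g
    refine Finset.mem_biUnion.2 ⟨(A, B), Finset.mem_offDiag.2 ⟨hA, hB, hAB⟩, ?_⟩
    rw [Fintype.mem_piFinset]
    exact fun j => Finset.mem_compl.2 (hg j)
  have hcard : ((n : ℝ)) ^ m ≤ ∑ q ∈ 𝒩.offDiag, ((((symmDiff q.1 q.2)ᶜ).card : ℝ)) ^ m := by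
    have h1 := (Finset.card_le_card hcover).trans Finset.card_biUnion_le
    simp only [Finset.card_univ, Fintype.card_fun, Fintype.card_fin, Fintype.card_piFinset,
      Finset.prod_const] at h1
    exact_mod_cast h1
  have hterm : ∀ q ∈ 𝒩.offDiag,
      ((((symmDiff q.1 q.2)ᶜ).card : ℝ)) ^ m ≤ Real.exp (-(ε * m)) * (n : ℝ) ^ m := by
    intro q hq
    obtain ⟨h1, h2, h3⟩ := Finset.mem_offDiag.1 hq
    have h4 := hsep _ h1 _ h2 h3
    have h5 : (((symmDiff q.1 q.2)ᶜ).card : ℝ) = n - (symmDiff q.1 q.2).card := by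
      rw [Finset.card_compl, Nat.cast_sub (Finset.card_le_univ _)]
    have h6 : (((symmDiff q.1 q.2)ᶜ).card : ℝ) ≤ Real.exp (-ε) * n := by
      rw [h5]
      have := Real.add_one_le_exp (-ε)
      nlinarith
    calc _ ≤ (Real.exp (-ε) * n) ^ m := pow_le_pow_left₀ (by positivity) h6 m
      _ = _ := by rw [mul_pow, ← Real.exp_nat_mul]; ring_nf
  have hoff : (𝒩.offDiag.card : ℝ) ≤ (𝒩.card : ℝ) ^ 2 := by
    rw [Finset.offDiag_card, sq]
    exact_mod_cast Nat.sub_le _ _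
  have h7 : (n : ℝ) ^ m ≤ (𝒩.card : ℝ) ^ 2 * (Real.exp (-(ε * m)) * (n : ℝ) ^ m) := by
    refine hcard.trans ((Finset.sum_le_card_nsmul _ _ _ hterm).trans ?_)
    rw [nsmul_eq_mul]
    gcongr
  have h8 : (0 : ℝ) < (n : ℝ) ^ m := by positivity
  nlinarith

/-- **Dudley's packing bound** for set families of bounded VC dimension. -/
theorem card_le_of_separated (𝒩 : Finset (Finset α)) {V : ℕ} (hV : 𝒩.vcDim ≤ V) {ε : ℝ}
    (hε : 0 < ε) (hε1 : ε ≤ 1)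
    (hsep : ∀ A ∈ 𝒩, ∀ B ∈ 𝒩, A ≠ B → ε * Fintype.card α < ((symmDiff A B).card : ℝ)) :
    (𝒩.card : ℝ) ≤ 2 * (4 / ε) ^ (2 * V) := by
  have hone : (1 : ℝ) ≤ (4 / ε) ^ (2 * V) := one_le_pow₀ (by rw [le_div_iff₀ hε]; linarith)
  rcases Nat.lt_or_ge 1 𝒩.card with hN | hN
  swap
  · have : (𝒩.card : ℝ) ≤ 1 := by exact_mod_cast hN
    linarith
  have : Nonempty α := by
    obtain ⟨A, hA, B, hB, hAB⟩ := Finset.one_lt_card.1 hN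
    by_contra hemp
    rw [not_nonempty_iff] at hemp
    exact hAB (Subsingleton.elim _ _)
  set N : ℝ := (𝒩.card : ℝ) with hNdef
  have hN0 : 0 < N := by rw [hNdef]; exact_mod_cast (by omega : 0 < 𝒩.card)
  set m : ℕ := ⌊2 * Real.log N / ε⌋₊ + 1 with hmdef
  have hlog : 0 ≤ Real.log N := Real.log_nonneg (by rw [hNdef]; exact_mod_cast hN.le)
  have hm1 : 2 * Real.log N < ε * m := by
    have h := Nat.lt_floor_add_one (2 * Real.log N / ε)
    rw [div_lt_iff₀ hε] at h
    rw [hmdef]; push_cast; linarith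
  have hm2 : ε * m ≤ 2 * Real.log N + 1 := by
    have h := Nat.floor_le (a := 2 * Real.log N / ε) (by positivity)
    rw [le_div_iff₀ hε] at h
    rw [hmdef]; push_cast; linarith
  have hNexp : N = Real.exp (Real.log N) := (Real.exp_log hN0).symm
  obtain ⟨g, hg⟩ := exists_separating_sample 𝒩 hsep (m := m) (by
    rw [← hNdef, hNexp, ← Real.exp_nat_mul, ← Real.exp_add]
    rw [← Real.exp_zero]; exact Real.exp_lt_exp.2 (by push_cast; linarith))
  have hinj : Set.InjOn (fun A : Finset α => Finset.univ.filter fun j => g j ∈ A) 𝒩 := by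
    intro A hA B hB hAB
    by_contra hne
    obtain ⟨j, hj⟩ := hg A hA B hB hne
    have := Finset.ext_iff.1 hAB j
    simp only [Finset.mem_filter, Finset.mem_univ, true_and] at this
    rw [Finset.mem_symmDiff] at hj
    tauto
  -- With `t = ε / 4` the exponential factor is at most a constant times `√N`; squaring then lets
  -- one factor `N` cancel.
  have hbound := card_le_of_vcDim_le _ ((vcDim_image_preimage_le 𝒩 g).trans hV)
    (t := ε / 4) (by positivity) (by linarith)
  rw [Finset.card_image_of_injOn hinj, ← hNdef, Fintype.card_fin, inv_div] at hbound
  have h1 : N ≤ (4 / ε) ^ V * Real.exp (Real.log N / 2 + 1 / 4) :=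
    hbound.trans (by gcongr; linarith)
  have h2 : N * N ≤ ((4 / ε) ^ V * Real.exp (Real.log N / 2 + 1 / 4)) ^ 2 := by
    rw [← sq]; exact pow_le_pow_left₀ hN0.le h1 2
  have h3 : ((4 / ε) ^ V * Real.exp (Real.log N / 2 + 1 / 4)) ^ 2
      = N * ((4 / ε) ^ (2 * V) * Real.exp (1 / 2)) := by
    conv_rhs => rw [hNexp, pow_mul']
    rw [mul_pow, ← Real.exp_nat_mul, mul_left_comm, ← Real.exp_add]
    congr 2
    push_cast; ring
  rw [h3] at h2
  have h4 : Real.exp (1 / 2) ≤ 2 := by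
    have h : Real.exp (1 / 2) ^ 2 ≤ 2 ^ 2 := by
      rw [← Real.exp_nat_mul]
      have := Real.exp_one_lt_d9
      norm_num
      linarith
    exact le_of_sq_le_sq h (by norm_num)
  have h5 := le_of_mul_le_mul_left h2 hN0
  nlinarith

/-- Every set family of bounded VC dimension has small nets for the Hamming distance. -/
theorem exists_net (𝒜 : Finset (Finset α)) {V : ℕ} (hV : 𝒜.vcDim ≤ V) {ε : ℝ}
    (hε : 0 < ε) (hε1 : ε ≤ 1) :
    ∃ p : Finset α → Finset α,
      (∀ A ∈ 𝒜, ((symmDiff A (p A)).card : ℝ) ≤ ε * Fintype.card α) ∧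
      ((𝒜.image p).card : ℝ) ≤ 2 * (4 / ε) ^ (2 * V) := by
  classical
  let sep : Finset (Finset α) → Prop := fun 𝒩 =>
    ∀ A ∈ 𝒩, ∀ B ∈ 𝒩, A ≠ B → ε * Fintype.card α < ((symmDiff A B).card : ℝ)
  -- A separated subfamily of maximal size is a net: a set far from all its members could be added.
  obtain ⟨𝒩, h𝒩, hmax⟩ := Finset.exists_max_image (𝒜.powerset.filter sep) Finset.card
    ⟨∅, by simp [sep]⟩
  rw [Finset.mem_filter, Finset.mem_powerset] at h𝒩
  obtain ⟨hsub, hsep⟩ := h𝒩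
  have hnet : ∀ A ∈ 𝒜, ∃ B ∈ 𝒩, ((symmDiff A B).card : ℝ) ≤ ε * Fintype.card α := by
    intro A hA
    by_contra! hfar
    have hAn : A ∉ 𝒩 := fun h => by
      have := hfar A h
      rw [symmDiff_self] at this
      simp only [Finset.bot_eq_empty, Finset.card_empty, Nat.cast_zero] at this
      have : 0 ≤ ε * Fintype.card α := by positivity
      linarith
    have := hmax (insert A 𝒩) (by
      rw [Finset.mem_filter, Finset.mem_powerset]
      refine ⟨Finset.insert_subset hA hsub, fun C hC D hD hCD => ?_⟩
      rcases Finset.mem_insert.1 hC with rfl | hC' <;> rcases Finset.mem_insert.1 hD with rfl | hD'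
      · exact absurd rfl hCD
      · exact hfar D hD'
      · rw [symmDiff_comm]; exact hfar C hC'
      · exact hsep C hC' D hD' hCD)
    rw [Finset.card_insert_of_notMem hAn] at this
    omega
  choose! p hp hpd using hnet
  refine ⟨p, hpd, ?_⟩
  have h1 : (𝒜.image p).card ≤ 𝒩.card :=
    Finset.card_le_card (Finset.image_subset_iff.2 hp)
  have h2 := card_le_of_separated 𝒩 ((Finset.vcDim_mono hsub).trans hV) hε hε1 hsep
  exact (Nat.cast_le.2 h1).trans h2

end Packing

/-! ### Sub-Gaussian signs and chaining over set families. -/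

section Chaining

/-- The sign attached to a Boolean. -/
def boolSign (b : Bool) : ℝ := if b then 1 else -1

theorem abs_boolSign (b : Bool) : |boolSign b| = 1 := by cases b <;> simp [boolSign]

/-- The tangent-line form of Jensen's inequality for a sub-probability weight. -/
theorem exp_sum_le {ι : Type*} (s : Finset ι) (q u : ι → ℝ) (hq : ∀ i ∈ s, 0 ≤ q i)
    (hq1 : ∑ i ∈ s, q i ≤ 1) :
    Real.exp (∑ i ∈ s, q i * u i) ≤ ∑ i ∈ s, q i * Real.exp (u i) + (1 - ∑ i ∈ s, q i) := by
  set x := ∑ i ∈ s, q i * u i with hx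
  have htan : ∀ v : ℝ, Real.exp x * (1 + v - x) ≤ Real.exp v := by
    intro v
    have h := Real.add_one_le_exp (v - x)
    have h2 : Real.exp v = Real.exp x * Real.exp (v - x) := by rw [← Real.exp_add]; ring_nf
    rw [h2]
    exact mul_le_mul_of_nonneg_left (by linarith) (Real.exp_pos x).le
  have h1 : ∑ i ∈ s, q i * (Real.exp x * (1 + u i - x)) ≤ ∑ i ∈ s, q i * Real.exp (u i) :=
    Finset.sum_le_sum fun i hi => mul_le_mul_of_nonneg_left (htan _) (hq i hi)
  have h2 : ∑ i ∈ s, q i * (Real.exp x * (1 + u i - x))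
      = Real.exp x * ((∑ i ∈ s, q i) * (1 - x) + x) := by
    conv_rhs => rw [hx, ← hx, Finset.sum_mul, hx, ← Finset.sum_add_distrib, ← hx, Finset.mul_sum]
    exact Finset.sum_congr rfl fun i _ => by ring
  -- The missing mass `1 - ∑ q i` is placed at the point 0.
  have h3 := htan 0
  rw [Real.exp_zero] at h3
  nlinarith

theorem sum_succ_mul_half_pow_le (m : ℕ) :
    ∑ k ∈ Finset.range m, ((k : ℝ) + 1) * (1 / 2) ^ (k + 1) ≤ 2 := by
  have h : ∑ k ∈ Finset.range m, ((k : ℝ) + 1) * (1 / 2) ^ (k + 1) = 2 - (m + 2) * (1 / 2) ^ m := by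
    induction m with
    | zero => simp
    | succ k ih => rw [Finset.sum_range_succ, ih]; push_cast; ring
  rw [h]
  have : (0 : ℝ) ≤ (m + 2) * (1 / 2) ^ m := by positivity
  linarith

theorem sum_half_pow_le (m : ℕ) : ∑ k ∈ Finset.range m, (1 / 2 : ℝ) ^ (k + 1) ≤ 1 := by
  have h : ∑ k ∈ Finset.range m, (1 / 2 : ℝ) ^ (k + 1) = 1 - (1 / 2) ^ m := by
    induction m with
    | zero => simp
    | succ k ih => rw [Finset.sum_range_succ, ih]; ring
  rw [h]
  have : (0 : ℝ) ≤ (1 / 2) ^ m := by positivity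
  linarith

variable {α : Type*} [Fintype α] [DecidableEq α]

/-- Rademacher sums are sub-Gaussian. -/
theorem sum_exp_signs_le (a : α → ℝ) :
    ∑ σ : α → Bool, Real.exp (∑ i, boolSign (σ i) * a i)
      ≤ 2 ^ Fintype.card α * Real.exp ((∑ i, a i ^ 2) / 2) := by
  have h1 : ∑ σ : α → Bool, Real.exp (∑ i, boolSign (σ i) * a i)
      = ∏ i, ∑ b : Bool, Real.exp (boolSign b * a i) := by
    rw [Finset.prod_univ_sum, Fintype.piFinset_univ]
    exact Finset.sum_congr rfl fun σ _ => Real.exp_sum _ _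
  have h2 : ∀ i, ∑ b : Bool, Real.exp (boolSign b * a i) ≤ 2 * Real.exp (a i ^ 2 / 2) := by
    intro i
    have := Real.cosh_le_exp_half_sq (a i)
    rw [Real.cosh_eq] at this
    simp only [Fintype.sum_bool, boolSign, if_true, one_mul, Bool.false_eq_true, if_false,
      neg_mul]
    linarith
  rw [h1]
  refine (Finset.prod_le_prod (fun i _ => Finset.sum_nonneg fun _ _ => (Real.exp_pos _).le)
    fun i _ => h2 i).trans ?_
  rw [Finset.prod_mul_distrib, Finset.prod_const, Finset.card_univ, ← Real.exp_sum,
    Finset.sum_div]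

/-- The Rademacher sum over a set of indices. -/
def signSum (σ : α → Bool) (A : Finset α) : ℝ := ∑ i ∈ A, boolSign (σ i)

theorem signSum_sub (σ : α → Bool) (A B : Finset α) :
    signSum σ A - signSum σ B
      = ∑ i, boolSign (σ i) * ((if i ∈ A then 1 else 0) - if i ∈ B then 1 else 0) := by
  simp only [signSum, mul_sub, Finset.sum_sub_distrib, mul_ite, mul_one, mul_zero,
    Finset.sum_ite_mem, Finset.univ_inter]

/-- The increments of the sign process are sub-Gaussian with the Hamming distance as variance proxy.
The factor 2 pays for the absolute value, by adding the bounds for `c` and `-c`. -/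
theorem sum_exp_abs_signSum_sub_le (c : ℝ) (A B : Finset α) {d : ℝ}
    (hd : ((symmDiff A B).card : ℝ) ≤ d) :
    ∑ σ : α → Bool, Real.exp (c * |signSum σ A - signSum σ B|)
      ≤ 2 ^ Fintype.card α * (2 * Real.exp (c ^ 2 * d / 2)) := by
  let a : ℝ → α → ℝ := fun e i => e * ((if i ∈ A then 1 else 0) - if i ∈ B then 1 else 0)
  have hsq : ∀ e, ∑ i, a e i ^ 2 = e ^ 2 * (symmDiff A B).card := by
    intro e
    have : ∀ i, a e i ^ 2 = if i ∈ symmDiff A B then e ^ 2 else 0 := by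
      intro i
      by_cases h1 : i ∈ A <;> by_cases h2 : i ∈ B <;> simp [a, h1, h2, Finset.mem_symmDiff]
    simp only [this, Finset.sum_ite_mem, Finset.univ_inter, Finset.sum_const, nsmul_eq_mul]
    ring
  have hlin : ∀ e (σ : α → Bool),
      ∑ i, boolSign (σ i) * a e i = e * (signSum σ A - signSum σ B) := by
    intro e σ
    rw [signSum_sub, Finset.mul_sum]
    exact Finset.sum_congr rfl fun i _ => by simp only [a]; ring
  have hb : ∀ e, e ^ 2 = c ^ 2 → ∑ σ : α → Bool, Real.exp (e * (signSum σ A - signSum σ B))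
      ≤ 2 ^ Fintype.card α * Real.exp (c ^ 2 * d / 2) := by
    intro e he
    have h := sum_exp_signs_le (a e)
    simp only [hlin, hsq, he] at h
    refine h.trans ?_
    gcongr
  calc ∑ σ : α → Bool, Real.exp (c * |signSum σ A - signSum σ B|)
      ≤ ∑ σ : α → Bool, (Real.exp (c * (signSum σ A - signSum σ B))
          + Real.exp (-c * (signSum σ A - signSum σ B))) := by
        refine Finset.sum_le_sum fun σ _ => ?_
        rcases abs_choice (signSum σ A - signSum σ B) with h | h <;> rw [h]
        · have := Real.exp_pos (-c * (signSum σ A - signSum σ B))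
          linarith
        · rw [mul_neg, ← neg_mul]
          have := Real.exp_pos (c * (signSum σ A - signSum σ B))
          linarith
    _ ≤ _ := by
        rw [Finset.sum_add_distrib]
        have h1 := hb c rfl
        have h2 := hb (-c) (by ring)
        linarith

/-- A chain of nets `∅ = p 0, p 1, …, p (κ + 1) = id` for a set family. -/
theorem exists_chain (𝒜 : Finset (Finset α)) {V : ℕ} (hV : 𝒜.vcDim ≤ V) :
    ∃ (κ : ℕ) (p : ℕ → Finset α → Finset α), (∀ A, p 0 A = ∅) ∧ (∀ A ∈ 𝒜, p κ A = A) ∧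
      (∀ k, ∀ A ∈ 𝒜, ((symmDiff (p (k + 1) A) (p k A)).card : ℝ)
        ≤ 5 * (1 / 4) ^ k * Fintype.card α) ∧
      ∀ k, ((𝒜.image (p k)).card : ℝ) ≤ 2 * (4 : ℝ) ^ (2 * V * k) := by
  have hnet := fun k : ℕ => exists_net 𝒜 hV (ε := (1 / 4) ^ k) (by positivity)
    (pow_le_one₀ (by norm_num) (by norm_num))
  choose π hπ hcard using hnet
  -- At a scale below one point, the net approximation is exact.
  obtain ⟨κ, hκ⟩ := exists_pow_lt_of_lt_one
    (show (0 : ℝ) < 1 / (Fintype.card α + 1) by positivity) (show (1 / 4 : ℝ) < 1 by norm_num)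
  rw [lt_div_iff₀ (by positivity)] at hκ
  -- Indices are shifted by one: level 0 is `∅`, level `k + 1` is the net at scale `(1 / 4) ^ k`.
  -- The 5 is `1 + 4`, from two consecutive scales.
  refine ⟨κ + 1, fun k => Nat.casesOn k (fun _ => ∅) π, fun _ => rfl, fun A hA => ?_,
    fun k A hA => ?_, fun k => ?_⟩
  · have h1 := hπ κ A hA
    have h2 : (0 : ℝ) < (1 / 4) ^ κ := by positivity
    have h3 : ((symmDiff A (π κ A)).card : ℝ) < 1 := by nlinarith
    have h4 : (symmDiff A (π κ A)).card = 0 := by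
      have : (symmDiff A (π κ A)).card < 1 := by exact_mod_cast h3
      omega
    rw [Finset.card_eq_zero, ← Finset.bot_eq_empty, symmDiff_eq_bot] at h4
    exact h4.symm
  · cases k with
    | zero =>
      have : ((symmDiff (π 0 A) ∅).card : ℝ) ≤ Fintype.card α := by
        exact_mod_cast Finset.card_le_univ _
      refine this.trans ?_
      rw [pow_zero, mul_one]
      have h0 : (0 : ℝ) ≤ Fintype.card α := by positivity
      linarith
    | succ k =>
      have h1 := hπ (k + 1) A hA
      have h2 := hπ k A hA
      have h3 : (symmDiff (π (k + 1) A) (π k A)).card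
          ≤ (symmDiff A (π (k + 1) A)).card + (symmDiff A (π k A)).card := by
        refine (Finset.card_le_card ?_).trans (Finset.card_union_le _ _)
        have := symmDiff_triangle (π (k + 1) A) A (π k A)
        rwa [symmDiff_comm (π (k + 1) A) A] at this
      have h4 : ((symmDiff (π (k + 1) A) (π k A)).card : ℝ)
          ≤ (symmDiff A (π (k + 1) A)).card + (symmDiff A (π k A)).card := by exact_mod_cast h3
      refine h4.trans ((add_le_add h1 h2).trans (le_of_eq ?_))
      ring
  · cases k with
    | zero =>
      have : (𝒜.image fun _ => (∅ : Finset α)).card ≤ 1 :=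
        Finset.card_le_one.2 fun a ha b hb => by
          obtain ⟨_, _, rfl⟩ := Finset.mem_image.1 ha
          obtain ⟨_, _, rfl⟩ := Finset.mem_image.1 hb
          rfl
      have : ((𝒜.image fun _ => (∅ : Finset α)).card : ℝ) ≤ 1 := by exact_mod_cast this
      refine this.trans ?_
      rw [mul_zero, pow_zero]
      norm_num
    | succ k =>
      refine (hcard k).trans (le_of_eq ?_)
      rw [one_div, inv_pow, div_inv_eq_mul, ← pow_succ', ← pow_mul]
      ring_nf

/-- **Chaining bound**: the exponential moment of the supremum of a Rademacher process indexed by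
a set family of VC dimension at most `V`. -/
theorem sum_exp_signSum_le (𝒜 : Finset (Finset α)) {V : ℕ} (hV : 𝒜.vcDim ≤ V) (hV1 : 1 ≤ V)
    (c : ℝ) (hc : 0 ≤ c) (a : (α → Bool) → Finset α) (ha : ∀ σ, a σ ∈ 𝒜) :
    ∑ σ : α → Bool, Real.exp (c * |signSum σ (a σ)|)
      ≤ 2 ^ Fintype.card α * Real.exp (16 * V + 10 * c ^ 2 * Fintype.card α) := by
  obtain ⟨κ, p, hp0, hpκ, hd, hcard⟩ := exists_chain 𝒜 hV
  set n := Fintype.card α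
  -- The weights `q k` match the link lengths: squared lengths decay like `(1 / 4) ^ k`,
  -- proportionally to `q k ^ 2`, so after rescaling every link has the same exponent `10 * c ^ 2 *
  -- n`. The penalties `b k` absorb the logarithm of the number of links.
  let q : ℕ → ℝ := fun k => (1 / 2) ^ (k + 1)
  let b : ℕ → ℝ := fun k => 8 * V * (k + 1)
  let Y : ℕ → (α → Bool) → ℝ := fun k σ =>
    |signSum σ (p (k + 1) (a σ)) - signSum σ (p k (a σ))|
  have hq : ∀ k, 0 < q k := fun k => by positivity
  have hq1 : ∑ k ∈ Finset.range κ, q k ≤ 1 := sum_half_pow_le κ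
  have hqb : ∑ k ∈ Finset.range κ, q k * b k ≤ 16 * V := by
    have h := sum_succ_mul_half_pow_le κ
    have h2 : ∑ k ∈ Finset.range κ, q k * b k
        = 8 * V * ∑ k ∈ Finset.range κ, ((k : ℝ) + 1) * (1 / 2) ^ (k + 1) := by
      rw [Finset.mul_sum]
      exact Finset.sum_congr rfl fun k _ => by simp only [q, b]; ring
    rw [h2]
    nlinarith [(Nat.cast_nonneg V : (0 : ℝ) ≤ V)]
  have htel : ∀ σ, |signSum σ (a σ)| ≤ ∑ k ∈ Finset.range κ, Y k σ := by
    intro σ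
    have h := Finset.sum_range_sub (fun k => signSum σ (p k (a σ))) κ
    rw [hpκ _ (ha σ), hp0] at h
    have h0 : signSum σ (∅ : Finset α) = 0 := by simp [signSum]
    rw [h0, sub_zero] at h
    rw [← h]
    exact Finset.abs_sum_le_sum_abs _ _
  have hlink : ∀ k, ∑ σ : α → Bool, Real.exp (c / q k * Y k σ)
      ≤ 2 ^ n * (Real.exp (b k) * Real.exp (10 * c ^ 2 * n)) := by
    intro k
    let pairs := 𝒜.image fun A => (p (k + 1) A, p k A)
    have hsub : pairs ⊆ (𝒜.image (p (k + 1))) ×ˢ (𝒜.image (p k)) := by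
      intro x hx
      obtain ⟨A, hA, rfl⟩ := Finset.mem_image.1 hx
      exact Finset.mem_product.2 ⟨Finset.mem_image_of_mem _ hA, Finset.mem_image_of_mem _ hA⟩
    have hpairs : (pairs.card : ℝ) * 2 ≤ Real.exp (b k) := by
      have h1 := Finset.card_le_card hsub
      rw [Finset.card_product] at h1
      have h2 : (pairs.card : ℝ) ≤ (𝒜.image (p (k + 1))).card * (𝒜.image (p k)).card := by
        exact_mod_cast h1
      have h3 : (𝒜.image (p (k + 1))).card * (𝒜.image (p k)).card
          ≤ (2 * (4 : ℝ) ^ (2 * V * (k + 1))) * (2 * (4 : ℝ) ^ (2 * V * (k + 1))) := by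
        refine mul_le_mul (hcard _) ((hcard k).trans ?_) (by positivity) (by positivity)
        gcongr
        · norm_num
        · omega
      have hone : 1 ≤ V * (k + 1) := Nat.mul_pos hV1 k.succ_pos
      -- Because `V ≥ 1`, the prefactor 8 can be raised to the power `V * (k + 1)`; then `8 * 4 ^ 4
      -- = 2048 ≤ exp 8` explains the 8 in `b`.
      have h4 : (8 : ℝ) ≤ 8 ^ (V * (k + 1)) := le_self_pow₀ (by norm_num) (by omega)
      have h5 : (2048 : ℝ) ≤ Real.exp 8 := by
        have h6 : (2.7 : ℝ) ^ 8 ≤ Real.exp 1 ^ 8 :=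
          pow_le_pow_left₀ (by norm_num) (by linarith [Real.exp_one_gt_d9]) 8
        rw [← Real.exp_nat_mul] at h6
        norm_num at h6
        linarith
      calc (pairs.card : ℝ) * 2 ≤ 8 * (4 : ℝ) ^ (4 * (V * (k + 1))) := by
            have : (4 : ℝ) ^ (4 * (V * (k + 1)))
              = 4 ^ (2 * V * (k + 1)) * 4 ^ (2 * V * (k + 1)) := by
                rw [← pow_add]; ring_nf
            rw [this]
            linarith
        _ ≤ 8 ^ (V * (k + 1)) * (4 : ℝ) ^ (4 * (V * (k + 1))) := by gcongr
        _ = 2048 ^ (V * (k + 1)) := by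
            rw [pow_mul (4 : ℝ) 4, ← mul_pow]; norm_num
        _ ≤ Real.exp 8 ^ (V * (k + 1)) := pow_le_pow_left₀ (by norm_num) h5 _
        _ = Real.exp (b k) := by
            rw [← Real.exp_nat_mul]; congr 1; simp only [b]; push_cast; ring
    have hq2 : (c / q k) ^ 2 * (5 * (1 / 4) ^ k * n) / 2 = 10 * c ^ 2 * n := by
      have : (1 / 4 : ℝ) ^ k = 4 * (q k) ^ 2 := by
        simp only [q]
        rw [← pow_mul, mul_comm (k + 1) 2, pow_mul, pow_succ]
        norm_num
        ring
      rw [this]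
      have := (hq k).ne'
      field_simp
      ring
    calc ∑ σ : α → Bool, Real.exp (c / q k * Y k σ)
        ≤ ∑ σ : α → Bool, ∑ x ∈ pairs,
            Real.exp (c / q k * |signSum σ x.1 - signSum σ x.2|) := by
          refine Finset.sum_le_sum fun σ _ => ?_
          exact Finset.single_le_sum
            (f := fun x : Finset α × Finset α =>
              Real.exp (c / q k * |signSum σ x.1 - signSum σ x.2|))
            (fun _ _ => (Real.exp_pos _).le)
            (Finset.mem_image_of_mem (fun A => (p (k + 1) A, p k A)) (ha σ))
      _ = ∑ x ∈ pairs, ∑ σ : α → Bool,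
            Real.exp (c / q k * |signSum σ x.1 - signSum σ x.2|) := Finset.sum_comm
      _ ≤ ∑ x ∈ pairs, 2 ^ n * (2 * Real.exp (10 * c ^ 2 * n)) := by
          refine Finset.sum_le_sum fun x hx => ?_
          obtain ⟨A, hA, rfl⟩ := Finset.mem_image.1 hx
          have := sum_exp_abs_signSum_sub_le (c / q k) _ _ (hd k A hA)
          rwa [hq2] at this
      _ = 2 ^ n * (((pairs.card : ℝ) * 2) * Real.exp (10 * c ^ 2 * n)) := by
          rw [Finset.sum_const, nsmul_eq_mul]; ring
      _ ≤ _ := by gcongr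
  -- Convexity of `exp` turns the sum of links into a weighted sum of separate exponentials, so the
  -- dependence between links plays no role.
  have hpt : ∀ σ, Real.exp (c * |signSum σ (a σ)|) ≤ Real.exp (16 * V) *
      (∑ k ∈ Finset.range κ, q k * (Real.exp (-b k) * Real.exp (c / q k * Y k σ))
        + (1 - ∑ k ∈ Finset.range κ, q k)) := by
    intro σ
    have h1 : c * |signSum σ (a σ)|
        ≤ 16 * V + ∑ k ∈ Finset.range κ, q k * (-b k + c / q k * Y k σ) := by
      have h2 : ∑ k ∈ Finset.range κ, q k * (-b k + c / q k * Y k σ)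
          = c * ∑ k ∈ Finset.range κ, Y k σ - ∑ k ∈ Finset.range κ, q k * b k := by
        rw [Finset.mul_sum, ← Finset.sum_sub_distrib]
        refine Finset.sum_congr rfl fun k _ => ?_
        have := (hq k).ne'
        field_simp
        ring
      rw [h2]
      have := mul_le_mul_of_nonneg_left (htel σ) hc
      linarith
    refine (Real.exp_le_exp.2 h1).trans ?_
    rw [Real.exp_add]
    refine mul_le_mul_of_nonneg_left ?_ (Real.exp_pos _).le
    simp only [← Real.exp_add]
    exact exp_sum_le _ _ _ (fun k _ => (hq k).le) hq1
  have hE : 1 ≤ Real.exp (10 * c ^ 2 * n) := Real.one_le_exp (by positivity)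
  calc ∑ σ : α → Bool, Real.exp (c * |signSum σ (a σ)|)
      ≤ ∑ σ : α → Bool, Real.exp (16 * V) *
        (∑ k ∈ Finset.range κ, q k * (Real.exp (-b k) * Real.exp (c / q k * Y k σ))
          + (1 - ∑ k ∈ Finset.range κ, q k)) := Finset.sum_le_sum fun σ _ => hpt σ
    _ = Real.exp (16 * V) * (∑ k ∈ Finset.range κ,
          q k * (Real.exp (-b k) * ∑ σ : α → Bool, Real.exp (c / q k * Y k σ))
          + 2 ^ n * (1 - ∑ k ∈ Finset.range κ, q k)) := by
        rw [← Finset.mul_sum, Finset.sum_add_distrib, Finset.sum_comm]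
        simp only [Finset.mul_sum, Finset.sum_const, Finset.card_univ, Fintype.card_fun,
          Fintype.card_bool, nsmul_eq_mul, Nat.cast_pow, Nat.cast_ofNat, n]
    _ ≤ Real.exp (16 * V) * (∑ k ∈ Finset.range κ,
          q k * (2 ^ n * Real.exp (10 * c ^ 2 * n))
          + 2 ^ n * (1 - ∑ k ∈ Finset.range κ, q k)) := by
        refine mul_le_mul_of_nonneg_left (add_le_add_left (Finset.sum_le_sum fun k _ =>
          mul_le_mul_of_nonneg_left ?_ (hq k).le) _) (Real.exp_pos _).le
        · refine (mul_le_mul_of_nonneg_left (hlink k) (Real.exp_pos _).le).trans (le_of_eq ?_)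
          rw [Real.exp_neg]
          have := (Real.exp_pos (b k)).ne'
          field_simp
    _ ≤ Real.exp (16 * V) * (2 ^ n * Real.exp (10 * c ^ 2 * n)) := by
        rw [← Finset.sum_mul]
        gcongr
        have h2 : (0 : ℝ) < 2 ^ n := by positivity
        have h3 := mul_le_mul_of_nonneg_left hE h2.le
        nlinarith
    _ = _ := by rw [Real.exp_add]; ring

end Chaining

/-! ### From superlevel sets to bounded functions. -/

section LayerCake

variable {α : Type*} [Fintype α]

theorem integral_indicator_level {L y : ℝ} (hy : |y| ≤ L) :
    ∫ β in (-L)..L, (if β ≤ y then (1 : ℝ) else 0) = y + L := by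
  obtain ⟨h1, h2⟩ := abs_le.1 hy
  have hf : (fun β : ℝ => if β ≤ y then (1 : ℝ) else 0) = (Iic y).indicator fun _ => 1 := by
    ext β; simp [Set.indicator_apply]
  rw [hf, intervalIntegral.integral_of_le (by linarith), integral_indicator measurableSet_Iic,
    Measure.restrict_restrict measurableSet_Iic, Set.inter_comm, Set.Ioc_inter_Iic, min_eq_right h2]
  simp only [integral_const, MeasurableSet.univ, measureReal_restrict_apply, Set.univ_inter,
    smul_eq_mul, mul_one, Real.volume_real_Ioc]
  rw [max_eq_left (by linarith)]
  ring

theorem intervalIntegrable_indicator_level (L y : ℝ) :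
    IntervalIntegrable (fun β : ℝ => if β ≤ y then (1 : ℝ) else 0) volume (-L) L := by
  have hf : (fun β : ℝ => if β ≤ y then (1 : ℝ) else 0) = (Iic y).indicator fun _ => 1 := by
    ext β; simp [Set.indicator_apply]
  rw [hf, intervalIntegrable_iff]
  exact (integrableOn_const (by simp) (by simp)).indicator measurableSet_Iic

/-- A Rademacher average of bounded reals is controlled by those of its superlevel sets. -/
theorem abs_sum_boolSign_mul_le (σ : α → Bool) (y : α → ℝ) {L C : ℝ} (hy : ∀ i, |y i| ≤ L)
    (hL : 0 ≤ L)
    (hC : ∀ β : ℝ, |signSum σ (Finset.univ.filter fun i => β ≤ y i)| ≤ C) :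
    |∑ i, boolSign (σ i) * y i| ≤ 3 * L * C := by
  -- Each `y i` is the integral over `[-L, L]` of its level indicators, minus `L`. The integral
  -- costs `2 * L * C`; the correction is `L` times the sum over the level `-L`, which is the whole
  -- index set. Hence `3 * L`.
  have h1 : ∑ i, boolSign (σ i) * y i
      = (∫ β in (-L)..L, signSum σ (Finset.univ.filter fun i => β ≤ y i))
        - L * signSum σ (Finset.univ.filter fun i => -L ≤ y i) := by
    have h2 : ∀ β : ℝ, signSum σ (Finset.univ.filter fun i => β ≤ y i)
        = ∑ i, boolSign (σ i) * (if β ≤ y i then (1 : ℝ) else 0) := fun β => by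
      simp [signSum, Finset.sum_filter]
    have h3 : (Finset.univ.filter fun i => -L ≤ y i) = Finset.univ :=
      Finset.filter_true_of_mem fun i _ => (abs_le.1 (hy i)).1
    rw [h3]
    simp only [h2]
    rw [intervalIntegral.integral_finsetSum fun i _ =>
      (intervalIntegrable_indicator_level L (y i)).const_mul _]
    simp only [intervalIntegral.integral_const_mul, integral_indicator_level (hy _), signSum,
      Finset.mul_sum, ← Finset.sum_sub_distrib]
    exact Finset.sum_congr rfl fun i _ => by ring
  have h4 : |∫ β in (-L)..L, signSum σ (Finset.univ.filter fun i => β ≤ y i)| ≤ C * (2 * L) := by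
    have h5 := intervalIntegral.norm_integral_le_of_norm_le_const (a := -L) (b := L) (C := C)
      (f := fun β => signSum σ (Finset.univ.filter fun i => β ≤ y i)) fun β _ => hC β
    rw [Real.norm_eq_abs] at h5
    refine h5.trans (le_of_eq ?_)
    rw [abs_of_nonneg (by linarith)]
    ring
  rw [h1]
  refine (abs_sub _ _).trans ?_
  rw [abs_mul, abs_of_nonneg hL]
  have := mul_le_mul_of_nonneg_left (hC (-L)) hL
  linarith

variable [DecidableEq α]

open Classical in
/-- The traces on a finite sample of the superlevel sets of a class of functions. -/
noncomputable def levelFamily {Z : Type*} (F : Set (Z → ℝ)) (x : α → Z) : Finset (Finset α) :=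
  Finset.univ.filter fun A => ∃ f ∈ F, ∃ β : ℝ, ∀ i, i ∈ A ↔ β ≤ f (x i)

/-- The sample may repeat points of `Z`, but a shattered index set maps injectively because its
singletons are cut out; its image is then shattered by thresholds. -/
theorem vcDim_levelFamily_le {Z : Type*} {F : Set (Z → ℝ)} {V : ℕ} (hV : VCDimLE F V)
    (x : α → Z) : (levelFamily F x).vcDim ≤ V := by
  classical
  refine Finset.sup_le fun t ht => ?_
  rw [Finset.mem_shatterer] at ht
  have key : ∀ u ⊆ t, ∃ f ∈ F, ∃ β : ℝ, ∀ i ∈ t, (i ∈ u ↔ β ≤ f (x i)) := by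
    intro u hu
    obtain ⟨A, hA, hAu⟩ := ht hu
    obtain ⟨f, hf, β, hβ⟩ := (Finset.mem_filter.1 hA).2
    refine ⟨f, hf, β, fun i hi => ?_⟩
    rw [← hβ, ← hAu]
    simp [hi]
  have hinj : Set.InjOn x t := by
    intro i hi j hj hij
    obtain ⟨f, -, β, h⟩ := key {i} (by simpa using hi)
    have h1 := (h i hi).1 (by simp)
    rw [hij] at h1
    exact (Finset.mem_singleton.1 ((h j hj).2 h1)).symm
  rw [← Finset.card_image_of_injOn hinj]
  refine hV _ fun U hU => ?_
  obtain ⟨f, hf, β, h⟩ := key (t.filter fun i => x i ∈ U) (Finset.filter_subset _ _)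
  refine ⟨f, hf, β, fun z hz => ?_⟩
  obtain ⟨i, hi, rfl⟩ := Finset.mem_image.1 hz
  rw [← h i hi]
  simp [hi]

/-- The exponential moment of the supremum of the Rademacher process of a bounded VC class. -/
theorem sum_exp_rademacher_le {Z : Type*} {F : Set (Z → ℝ)} {V : ℕ} (hV : VCDimLE F V)
    (hV1 : 1 ≤ V) {L : ℝ} (hL : 0 ≤ L) (hF : ∀ f ∈ F, ∀ z, |f z| ≤ L) (x : α → Z)
    (g : (α → Bool) → Z → ℝ) (hg : ∀ σ, g σ ∈ F) (c : ℝ) (hc : 0 ≤ c) :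
    ∑ σ : α → Bool, Real.exp (c * |∑ i, boolSign (σ i) * g σ (x i)|)
      ≤ 2 ^ Fintype.card α * Real.exp (16 * V + 90 * c ^ 2 * L ^ 2 * Fintype.card α) := by
  classical
  have hmem : ∀ f ∈ F, ∀ β : ℝ, (Finset.univ.filter fun i => β ≤ f (x i)) ∈ levelFamily F x :=
    fun f hf β => Finset.mem_filter.2 ⟨Finset.mem_univ _, f, hf, β, by simp⟩
  -- The worst level set may depend on `σ`; the chaining bound holds for any selection.
  have hmax := fun σ : α → Bool => Finset.exists_max_image (levelFamily F x)
    (fun A => |signSum σ A|) ⟨_, hmem _ (hg σ) 0⟩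
  choose a ha hamax using hmax
  have h := sum_exp_signSum_le (levelFamily F x) (vcDim_levelFamily_le hV x) hV1 (c * (3 * L))
    (by positivity) a ha
  calc _ ≤ ∑ σ : α → Bool, Real.exp (c * (3 * L) * |signSum σ (a σ)|) := by
        refine Finset.sum_le_sum fun σ _ => Real.exp_le_exp.2 ?_
        rw [mul_assoc]
        exact mul_le_mul_of_nonneg_left (abs_sum_boolSign_mul_le σ _ (fun i => hF _ (hg σ) _) hL
          fun β => hamax σ _ (hmem _ (hg σ) β)) hc
    _ ≤ _ := h.trans (le_of_eq (by ring_nf))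

end LayerCake

/-! ### Ghost samples and deviation inequalities. -/

section Symmetrization

variable {Z : Type*} [MeasurableSpace Z]

theorem abs_sum_le_card_mul {α : Type*} [Fintype α] (y : α → ℝ) {C : ℝ} (h : ∀ i, |y i| ≤ C) :
    |∑ i, y i| ≤ Fintype.card α * C := by
  refine (Finset.abs_sum_le_sum_abs _ _).trans ?_
  simpa using Finset.sum_le_card_nsmul Finset.univ _ C fun i _ => h i

/-- Symmetrization and chaining: the exponential moment of the uniform deviation of empirical
sums over a finite subclass of a bounded VC class. -/
theorem integral_exp_deviation_le {F : Set (Z → ℝ)} {V : ℕ} (hV : VCDimLE F V)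
    (hV1 : 1 ≤ V) {L : ℝ} (hL : 0 ≤ L) (hF : ∀ f ∈ F, ∀ z, |f z| ≤ L)
    (μ : Measure Z) [IsProbabilityMeasure μ] {ι : Type*} [Finite ι] [Nonempty ι]
    (f : ι → Z → ℝ) (hf : ∀ j, f j ∈ F) (hfm : ∀ j, Measurable (f j)) (n : ℕ) (c : ℝ)
    (hc : 0 ≤ c) :
    ∫ z, ⨆ j, Real.exp (c * |∑ i, (f j (z i) - ∫ y, f j y ∂μ)|) ∂(Measure.pi fun _ : Fin n => μ)
      ≤ Real.exp (16 * V + 360 * c ^ 2 * L ^ 2 * n) := by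
  set P : Measure (Fin n → Z) := Measure.pi fun _ => μ
  set P2 : Measure (Fin n → Z × Z) := Measure.pi fun _ => μ.prod μ
  let bnd : ℝ := Real.exp (c * (n * (2 * L)))
  have hbdd : ∀ g : ι → ℝ, BddAbove (range g) := fun g => (Set.finite_range g).bddAbove
  -- the symmetrized process
  let H : (Fin n → Bool) → (Fin n → Z × Z) → ℝ := fun σ w =>
    ⨆ j, Real.exp (c * |∑ i, boolSign (σ i) * (f j (w i).1 - f j (w i).2)|)
  have hdiff : ∀ j z z', |f j z - f j z'| ≤ 2 * L := fun j z z' => by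
    have := hF _ (hf j) z
    have := hF _ (hf j) z'
    exact (abs_sub _ _).trans (by linarith)
  have hHterm : ∀ (σ : Fin n → Bool) (w : Fin n → Z × Z) (j : ι),
      Real.exp (c * |∑ i, boolSign (σ i) * (f j (w i).1 - f j (w i).2)|) ≤ bnd := by
    intro σ w j
    refine Real.exp_le_exp.2 (mul_le_mul_of_nonneg_left ?_ hc)
    have := abs_sum_le_card_mul (fun i => boolSign (σ i) * (f j (w i).1 - f j (w i).2))
      (C := 2 * L) fun i => by rw [abs_mul, abs_boolSign, one_mul]; exact hdiff _ _ _
    simpa using this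
  have hHle : ∀ σ w, H σ w ≤ bnd := fun σ w => ciSup_le fun j => hHterm σ w j
  have hHpos : ∀ σ w, 0 ≤ H σ w := fun σ w =>
    Real.iSup_nonneg fun j => (Real.exp_pos _).le
  have hHm : ∀ σ, Measurable (H σ) := fun σ => by
    refine Measurable.iSup fun j => ?_
    have := hfm j
    fun_prop
  have hHint : ∀ σ, Integrable (H σ) P2 := fun σ =>
    Integrable.of_bound (hHm σ).aestronglyMeasurable bnd (Eventually.of_forall fun w => by
      rw [Real.norm_eq_abs, abs_of_nonneg (hHpos σ w)]; exact hHle σ w)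
  let tt : Fin n → Bool := fun _ => true
  -- exchanging coordinates
  have hswap : ∀ σ, ∫ w, H σ w ∂P2 = ∫ w, H tt w ∂P2 := by
    intro σ
    -- Where the sign is negative, the sample and its ghost are exchanged, which preserves the
    -- product law.
    let e : Fin n → Z × Z → Z × Z := fun i => if σ i then id else Prod.swap
    have he : MeasurePreserving (fun (w : Fin n → Z × Z) i => e i (w i)) P2 P2 := by
      refine measurePreserving_pi _ _ fun i => ?_
      by_cases h : σ i
      · simp only [e, h, if_true]; exact MeasurePreserving.id _
      · simp only [e, h]; exact Measure.measurePreserving_swap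
    rw [← he.map_eq]
    rw [integral_map he.measurable.aemeasurable (hHm _).aestronglyMeasurable, he.map_eq]
    congr 1
    ext w
    refine iSup_congr fun j => ?_
    congr 3
    refine Finset.sum_congr rfl fun i _ => ?_
    by_cases h : σ i <;> simp [e, h, boolSign, tt]
  -- the conditional bound
  have hcond : ∀ w, ∑ σ, H σ w ≤ 2 ^ n * Real.exp (16 * V + 360 * c ^ 2 * L ^ 2 * n) := by
    intro w
    have hsel : ∀ σ, ∃ j, Real.exp (c * |∑ i, boolSign (σ i) * (f j (w i).1 - f j (w i).2)|)
        = H σ w := fun σ => exists_eq_ciSup_of_finite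
    choose j hj using hsel
    -- The two halves of the double sample are decoupled by the arithmetic-geometric mean
    -- inequality. This doubles `c`, and `90 * 2 ^ 2 = 360`.
    have hpt : ∀ σ, H σ w ≤
        (Real.exp (2 * c * |∑ i, boolSign (σ i) * f (j σ) (w i).1|)
          + Real.exp (2 * c * |∑ i, boolSign (σ i) * f (j σ) (w i).2|)) / 2 := by
      intro σ
      rw [← hj σ]
      set a := |∑ i, boolSign (σ i) * f (j σ) (w i).1|
      set b := |∑ i, boolSign (σ i) * f (j σ) (w i).2|
      have h1 : |∑ i, boolSign (σ i) * (f (j σ) (w i).1 - f (j σ) (w i).2)| ≤ a + b := by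
        simp only [mul_sub, Finset.sum_sub_distrib]
        exact abs_sub _ _
      have h2 : Real.exp (c * |∑ i, boolSign (σ i) * (f (j σ) (w i).1 - f (j σ) (w i).2)|)
          ≤ Real.exp (c * a) * Real.exp (c * b) := by
        rw [← Real.exp_add, ← mul_add]
        exact Real.exp_le_exp.2 (mul_le_mul_of_nonneg_left h1 hc)
      have h3 : ∀ x, Real.exp (2 * c * x) = Real.exp (c * x) ^ 2 := fun x => by
        rw [← Real.exp_nat_mul]; push_cast; ring_nf
      rw [h3, h3]
      nlinarith [sq_nonneg (Real.exp (c * a) - Real.exp (c * b))]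
    have hA := sum_exp_rademacher_le hV hV1 hL hF (fun i => (w i).1) (fun σ => f (j σ))
      (fun σ => hf _) (2 * c) (by positivity)
    have hB := sum_exp_rademacher_le hV hV1 hL hF (fun i => (w i).2) (fun σ => f (j σ))
      (fun σ => hf _) (2 * c) (by positivity)
    rw [Fintype.card_fin] at hA hB
    have hr : 90 * (2 * c) ^ 2 * L ^ 2 * (n : ℝ) = 360 * c ^ 2 * L ^ 2 * n := by ring
    rw [hr] at hA hB
    refine (Finset.sum_le_sum fun σ _ => hpt σ).trans ?_
    rw [← Finset.sum_div, Finset.sum_add_distrib]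
    linarith
  have hsymm : ∫ w, H tt w ∂P2 ≤ Real.exp (16 * V + 360 * c ^ 2 * L ^ 2 * n) := by
    have h1 : ∫ w, ∑ σ, H σ w ∂P2 = 2 ^ n * ∫ w, H tt w ∂P2 := by
      rw [integral_finsetSum _ fun σ _ => hHint σ]
      simp [hswap]
    have h2 : ∫ w, ∑ σ, H σ w ∂P2
        ≤ ∫ _, 2 ^ n * Real.exp (16 * V + 360 * c ^ 2 * L ^ 2 * n) ∂P2 :=
      integral_mono (integrable_finsetSum _ fun σ _ => hHint σ) (integrable_const _) hcond
    rw [h1, integral_const, probReal_univ, one_smul] at h2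
    exact le_of_mul_le_mul_left h2 (by positivity)
  refine le_trans ?_ hsymm
  -- introducing the ghost sample
  let H2 : (Fin n → Z) × (Fin n → Z) → ℝ := fun q =>
    ⨆ j, Real.exp (c * |∑ i, (f j (q.1 i) - f j (q.2 i))|)
  have hH2 : ∀ w, H2 (MeasurableEquiv.arrowProdEquivProdArrow Z Z (Fin n) w) = H tt w := by
    intro w
    refine iSup_congr fun j => ?_
    simp [tt, boolSign, MeasurableEquiv.arrowProdEquivProdArrow, Equiv.arrowProdEquivProdArrow]
  have hmp := measurePreserving_arrowProdEquivProdArrow Z Z (Fin n) (fun _ => μ) (fun _ => μ)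
  have hghost : ∫ w, H tt w ∂P2 = ∫ q, H2 q ∂(P.prod P) := by
    rw [← hmp.integral_comp' (g := H2)]
    simp only [hH2]
    rfl
  have hH2m : Measurable H2 := by
    refine Measurable.iSup fun j => ?_
    have := hfm j
    fun_prop
  have hH2le : ∀ q, ‖H2 q‖ ≤ bnd := fun q => by
    obtain ⟨w, rfl⟩ := (MeasurableEquiv.arrowProdEquivProdArrow Z Z (Fin n)).surjective q
    rw [hH2, Real.norm_eq_abs, abs_of_nonneg (hHpos _ _)]
    exact hHle _ _
  have hH2int : Integrable H2 (P.prod P) :=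
    Integrable.of_bound hH2m.aestronglyMeasurable bnd (Eventually.of_forall hH2le)
  rw [hghost, integral_prod _ hH2int]
  -- The mean is an average over the ghost sample; Jensen's inequality pulls that average out of the
  -- exponential, and the supremum then goes inside it.
  have hpt : ∀ z, (⨆ j, Real.exp (c * |∑ i, (f j (z i) - ∫ y, f j y ∂μ)|))
      ≤ ∫ z', H2 (z, z') ∂P := by
    intro z
    refine ciSup_le fun j => ?_
    have hint1 : ∀ i : Fin n, Integrable (fun z' : Fin n → Z => f j (z i) - f j (z' i)) P :=
      fun i => Integrable.of_bound
        (by have := hfm j; exact Measurable.aestronglyMeasurable (by fun_prop)) (2 * L)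
        (Eventually.of_forall fun z' => hdiff j _ _)
    have hint : Integrable (fun z' : Fin n → Z => ∑ i, (f j (z i) - f j (z' i))) P :=
      integrable_finsetSum _ fun i _ => hint1 i
    have hfi : Integrable (f j) μ := Integrable.of_bound (hfm j).aestronglyMeasurable L
        (Eventually.of_forall fun z' => hF _ (hf j) _)
    have hmean : ∑ i, (f j (z i) - ∫ y, f j y ∂μ) = ∫ z', ∑ i, (f j (z i) - f j (z' i)) ∂P := by
      rw [integral_finsetSum _ fun i _ => hint1 i]
      refine Finset.sum_congr rfl fun i _ => ?_
      have hev : ∫ z' : Fin n → Z, f j (z' i) ∂P = ∫ y, f j y ∂μ := by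
        have he := measurePreserving_eval (fun _ : Fin n => μ) i
        have := integral_map (μ := P) he.measurable.aemeasurable
          (f := f j) (hfm j).aestronglyMeasurable
        rw [he.map_eq] at this
        exact this.symm
      rw [integral_sub (integrable_const _) (by
        have he := measurePreserving_eval (fun _ : Fin n => μ) i
        exact he.integrable_comp_of_integrable hfi), hev]
      simp
    have hsl : ∀ z', Real.exp (c * |∑ i, (f j (z i) - f j (z' i))|) ≤ H2 (z, z') := fun z' =>
      le_ciSup (f := fun j => Real.exp (c * |∑ i, (f j (z i) - f j (z' i))|)) (hbdd _) j
    have hmeasx : Measurable fun z' : Fin n → Z =>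
        Real.exp (c * |∑ i, (f j (z i) - f j (z' i))|) := by
      have := hfm j
      fun_prop
    have hintx : Integrable (fun z' : Fin n → Z =>
        Real.exp (c * |∑ i, (f j (z i) - f j (z' i))|)) P :=
      Integrable.of_bound hmeasx.aestronglyMeasurable bnd (Eventually.of_forall fun z' => by
        rw [Real.norm_eq_abs, abs_of_pos (Real.exp_pos _)]
        exact (hsl z').trans ((le_abs_self _).trans (hH2le _)))
    have hints : Integrable (fun z' => H2 (z, z')) P :=
      Integrable.of_bound (hH2m.comp measurable_prodMk_left).aestronglyMeasurable bnd
        (Eventually.of_forall fun z' => hH2le _)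
    have hjensen : Real.exp (∫ z', c * |∑ i, (f j (z i) - f j (z' i))| ∂P)
        ≤ ∫ z', Real.exp (c * |∑ i, (f j (z i) - f j (z' i))|) ∂P :=
      convexOn_exp.map_integral_le Real.continuous_exp.continuousOn isClosed_univ
        (Eventually.of_forall fun _ => mem_univ _) (hint.abs.const_mul c) hintx
    calc _ ≤ Real.exp (∫ z', c * |∑ i, (f j (z i) - f j (z' i))| ∂P) := by
          rw [hmean, integral_const_mul]
          exact Real.exp_le_exp.2 (mul_le_mul_of_nonneg_left (abs_integral_le_integral_abs) hc)
      _ ≤ _ := hjensen.trans (integral_mono hintx hints hsl)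
  refine integral_mono_of_nonneg (Eventually.of_forall fun z => ?_) hH2int.integral_prod_left
    (Eventually.of_forall hpt)
  exact Real.iSup_nonneg fun j => (Real.exp_pos _).le

/-- Deviation inequality for a finite subclass of a bounded VC class. -/
theorem measure_deviation_finite_le {F : Set (Z → ℝ)} {V : ℕ} (hV : VCDimLE F V)
    (hV1 : 1 ≤ V) {L : ℝ} (hL : 0 < L) (hF : ∀ f ∈ F, ∀ z, |f z| ≤ L)
    (μ : Measure Z) [IsProbabilityMeasure μ] {ι : Type*} [Finite ι] [Nonempty ι]
    (f : ι → Z → ℝ) (hf : ∀ j, f j ∈ F) (hfm : ∀ j, Measurable (f j)) {n : ℕ} (hn : 0 < n)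
    {δ : ℝ} (hδ : 0 < δ) (hδ1 : δ < 1) :
    (Measure.pi fun _ : Fin n => μ)
        {z | ∃ j, n * (160 * L * √((V - Real.log δ) / n)) < |∑ i, (f j (z i) - ∫ y, f j y ∂μ)|}
      ≤ ENNReal.ofReal δ := by
  set P : Measure (Fin n → Z) := Measure.pi fun _ => μ
  set x := √((V - Real.log δ) / n) with hx
  have hlog : Real.log δ < 0 := Real.log_neg hδ hδ1
  have hn' : (0 : ℝ) < n := by exact_mod_cast hn
  have hV' : (1 : ℝ) ≤ V := by exact_mod_cast hV1
  have hx2 : x ^ 2 * n = V - Real.log δ := by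
    rw [hx, Real.sq_sqrt (div_nonneg (by linarith) hn'.le)]
    field_simp
  have hx0 : 0 < x := Real.sqrt_pos.2 (div_pos (by linarith) hn')
  -- This minimizes `360 * c ^ 2 * L ^ 2 * n - c * u`. The minimum is `-(160 / 9) * (V - log δ)`,
  -- enough to absorb `16 * V` and leave `log δ`.
  set c := x / (4.5 * L) with hc
  have hc0 : 0 < c := by positivity
  set u := n * (160 * L * x) with hu
  let G : (Fin n → Z) → ℝ := fun z => ⨆ j, Real.exp (c * |∑ i, (f j (z i) - ∫ y, f j y ∂μ)|)
  have hmain := integral_exp_deviation_le hV hV1 hL.le hF μ f hf hfm n c hc0.le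
  have hGm : Measurable G := by
    refine Measurable.iSup fun j => ?_
    have := hfm j
    fun_prop
  have hGpos : ∀ z, 0 ≤ G z := fun z => Real.iSup_nonneg fun j => (Real.exp_pos _).le
  have hfint : ∀ j, |∫ y, f j y ∂μ| ≤ L := fun j => by
    have := norm_integral_le_of_norm_le_const (μ := μ) (f := f j) (C := L)
      (Eventually.of_forall fun z => hF _ (hf j) z)
    simpa using this
  have hGint : Integrable G P := by
    refine Integrable.of_bound hGm.aestronglyMeasurable (Real.exp (c * (n * (2 * L))))
      (Eventually.of_forall fun z => ?_)
    rw [Real.norm_eq_abs, abs_of_nonneg (hGpos z)]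
    refine ciSup_le fun j => Real.exp_le_exp.2 (mul_le_mul_of_nonneg_left ?_ hc0.le)
    have := abs_sum_le_card_mul (fun i => f j (z i) - ∫ y, f j y ∂μ) (C := 2 * L) fun i =>
      (abs_sub _ _).trans (by linarith [hF _ (hf j) (z i), hfint j])
    simpa using this
  have hmarkov := mul_meas_ge_le_integral_of_nonneg (Eventually.of_forall hGpos) hGint
    (Real.exp (c * u))
  have hsub : {z | ∃ j, u < |∑ i, (f j (z i) - ∫ y, f j y ∂μ)|}
      ⊆ {z | Real.exp (c * u) ≤ G z} := by
    rintro z ⟨j, hj⟩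
    refine le_trans (Real.exp_le_exp.2 (mul_le_mul_of_nonneg_left hj.le hc0.le)) ?_
    exact le_ciSup (f := fun j => Real.exp (c * |∑ i, (f j (z i) - ∫ y, f j y ∂μ)|))
      (Set.finite_range _).bddAbove j
  refine (measure_mono hsub).trans ?_
  rw [← ofReal_measureReal]
  refine ENNReal.ofReal_le_ofReal ?_
  have h1 : Real.exp (c * u) * P.real {z | Real.exp (c * u) ≤ G z}
      ≤ Real.exp (16 * V + 360 * c ^ 2 * L ^ 2 * n) := hmarkov.trans hmain
  have h2 : 16 * V + 360 * c ^ 2 * L ^ 2 * n ≤ c * u + Real.log δ := by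
    have e1 : c * L = x / 4.5 := by rw [hc]; field_simp
    have e2 : 360 * c ^ 2 * L ^ 2 * n = 360 / 4.5 ^ 2 * (V - Real.log δ) := by
      rw [← hx2]
      calc 360 * c ^ 2 * L ^ 2 * n = 360 * (c * L) ^ 2 * n := by ring
        _ = _ := by rw [e1]; ring
    have e3 : c * u = 160 / 4.5 * (V - Real.log δ) := by
      rw [← hx2, hu]
      calc c * (n * (160 * L * x)) = 160 * (c * L) * x * n := by ring
        _ = _ := by rw [e1]; ring
    rw [e2, e3]
    norm_num
    linarith
  have h3 := h1.trans (Real.exp_le_exp.2 h2)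
  rw [Real.exp_add, Real.exp_log hδ] at h3
  exact le_of_mul_le_mul_left h3 (Real.exp_pos _)

/-- Deviation inequality for a countable bounded VC class. -/
theorem measure_deviation_le {F : Set (Z → ℝ)} {V : ℕ} (hV : VCDimLE F V)
    (hV1 : 1 ≤ V) {L : ℝ} (hL : 0 < L) (hF : ∀ f ∈ F, ∀ z, |f z| ≤ L)
    (μ : Measure Z) [IsProbabilityMeasure μ]
    (f : ℕ → Z → ℝ) (hf : ∀ j, f j ∈ F) (hfm : ∀ j, Measurable (f j)) {n : ℕ} (hn : 0 < n)
    {δ : ℝ} (hδ : 0 < δ) (hδ1 : δ < 1) :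
    (Measure.pi fun _ : Fin n => μ)
        {z | ∃ j, n * (160 * L * √((V - Real.log δ) / n)) < |∑ i, (f j (z i) - ∫ y, f j y ∂μ)|}
      ≤ ENNReal.ofReal δ := by
  set u := n * (160 * L * √((V - Real.log δ) / n))
  -- The finite bound does not depend on the number of functions, so it survives an increasing
  -- union.
  let s : ℕ → Set (Fin n → Z) := fun k =>
    {z | ∃ j : Fin (k + 1), u < |∑ i, (f j (z i) - ∫ y, f j y ∂μ)|}
  have hunion : {z | ∃ j, u < |∑ i, (f j (z i) - ∫ y, f j y ∂μ)|} = ⋃ k, s k := by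
    ext z
    simp only [mem_ofPred_eq, mem_iUnion, s]
    exact ⟨fun ⟨j, hj⟩ => ⟨j, Fin.last j, hj⟩, fun ⟨_, j, hj⟩ => ⟨j, hj⟩⟩
  have hmono : Monotone s := fun k l hkl z ⟨j, hj⟩ =>
    ⟨Fin.castLE (by omega) j, hj⟩
  rw [hunion, hmono.measure_iUnion]
  exact iSup_le fun k => measure_deviation_finite_le hV hV1 hL hF μ
    (fun j : Fin (k + 1) => f j) (fun j => hf j) (fun j => hfm j) hn hδ hδ1

end Symmetrization

/-! ### Hellinger distance, Kullback-Leibler divergence and a Pinsker-type inequality. -/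

section Hellinger

/-- This is `log t ≤ t - 1` at `t = √q / √p`, multiplied by `2 * p`. The term `q - p` integrates to
zero for probability densities. -/
theorem sq_sqrt_sub_sqrt_le {p q : ℝ} (hp : 0 ≤ p) (hq : 0 < q) :
    (√p - √q) ^ 2 ≤ p * (Real.log p - Real.log q) + q - p := by
  rcases hp.eq_or_lt with rfl | hp
  · simp [Real.sq_sqrt hq.le]
  obtain ⟨a, ha, rfl⟩ : ∃ a, 0 < a ∧ p = a ^ 2 :=
    ⟨√p, Real.sqrt_pos.2 hp, (Real.sq_sqrt hp.le).symm⟩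
  obtain ⟨b, hb, rfl⟩ : ∃ b, 0 < b ∧ q = b ^ 2 :=
    ⟨√q, Real.sqrt_pos.2 hq, (Real.sq_sqrt hq.le).symm⟩
  rw [Real.sqrt_sq ha.le, Real.sqrt_sq hb.le, Real.log_pow, Real.log_pow]
  have h1 := Real.log_le_sub_one_of_pos (div_pos hb ha)
  rw [Real.log_div hb.ne' ha.ne'] at h1
  have h2 : a ^ 2 * (b / a) = a * b := by field_simp
  have h3 := mul_le_mul_of_nonneg_left h1 (sq_nonneg a)
  push_cast
  nlinarith

/-- Factor `p - q` through square roots and apply a weighted Young inequality. The free parameter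
`c` replaces Cauchy-Schwarz on integrals and is optimized after integration. -/
theorem abs_sub_le_of_hellinger {p q c : ℝ} (hp : 0 ≤ p) (hq : 0 < q) (hc : 0 < c) :
    |p - q| ≤ (2 * c)⁻¹ * (p * (Real.log p - Real.log q) + q - p) + c * (p + q) := by
  have h1 := sq_sqrt_sub_sqrt_le hp hq
  have h2 : |p - q| ≤ (2 * c)⁻¹ * (√p - √q) ^ 2 + c * (p + q) := by
    set a := √p
    set b := √q
    have ha : 0 ≤ a := Real.sqrt_nonneg p
    have hb : 0 ≤ b := Real.sqrt_nonneg q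
    have hpa : p = a ^ 2 := (Real.sq_sqrt hp).symm
    have hqb : q = b ^ 2 := (Real.sq_sqrt hq.le).symm
    have h3 : |p - q| = |a - b| * (a + b) := by
      rw [hpa, hqb, sq_sub_sq, abs_mul, abs_of_nonneg (add_nonneg ha hb), mul_comm]
    have h4 : (2 * c)⁻¹ * (a - b) ^ 2 + c * (p + q) - |a - b| * (a + b)
        = (2 * c)⁻¹ * ((|a - b| - c * (a + b)) ^ 2 + (c * (a - b)) ^ 2) := by
      rw [hpa, hqb, ← sq_abs (a - b)]
      field_simp
      ring
    have h5 : 0 ≤ (2 * c)⁻¹ * ((|a - b| - c * (a + b)) ^ 2 + (c * (a - b)) ^ 2) := by positivity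
    rw [h3]
    linarith
  have h6 : 0 ≤ (2 * c)⁻¹ := by positivity
  have := mul_le_mul_of_nonneg_left h1 h6
  linarith

variable {X : Type*} [MeasurableSpace X] {ν : Measure X} {p q : X → ℝ}

/-- The Kullback-Leibler divergence of two probability densities is nonnegative. -/
theorem integral_mul_log_sub_log_nonneg (hp : ∀ x, 0 ≤ p x) (hq : ∀ x, 0 < q x)
    (hpi : Integrable p ν) (hqi : Integrable q ν) (hpq : ∫ x, p x ∂ν = ∫ x, q x ∂ν)
    (hkl : Integrable (fun x => p x * (Real.log (p x) - Real.log (q x))) ν) :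
    0 ≤ ∫ x, p x * (Real.log (p x) - Real.log (q x)) ∂ν := by
  have h : 0 ≤ ∫ x, (p x * (Real.log (p x) - Real.log (q x)) + q x - p x) ∂ν :=
    integral_nonneg fun x => (sq_nonneg _).trans (sq_sqrt_sub_sqrt_le (hp x) (hq x))
  rw [integral_sub (f := fun x => p x * (Real.log (p x) - Real.log (q x)) + q x)
    (hkl.add hqi) hpi, integral_add hkl hqi, hpq] at h
  linarith

/-- A Pinsker-type inequality: the `L¹` distance of two densities is at most twice the square root
of their Kullback-Leibler divergence. -/
theorem integral_abs_sub_le_sqrt (hp : ∀ x, 0 ≤ p x) (hq : ∀ x, 0 < q x)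
    (hpi : Integrable p ν) (hqi : Integrable q ν) (hp1 : ∫ x, p x ∂ν = 1)
    (hq1 : ∫ x, q x ∂ν = 1)
    (hkl : Integrable (fun x => p x * (Real.log (p x) - Real.log (q x))) ν) :
    ∫ x, |p x - q x| ∂ν ≤ 2 * √(∫ x, p x * (Real.log (p x) - Real.log (q x)) ∂ν) := by
  set D := ∫ x, p x * (Real.log (p x) - Real.log (q x)) ∂ν with hD
  have hD0 : 0 ≤ D := integral_mul_log_sub_log_nonneg hp hq hpi hqi (hp1.trans hq1.symm) hkl
  have key : ∀ c, 0 < c → ∫ x, |p x - q x| ∂ν ≤ (2 * c)⁻¹ * D + 2 * c := by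
    intro c hc
    have h := integral_mono (hpi.sub hqi).abs
      ((((hkl.add hqi).sub hpi).const_mul (2 * c)⁻¹).add ((hpi.add hqi).const_mul c))
      fun x => abs_sub_le_of_hellinger (hp x) (hq x) hc
    refine h.trans (le_of_eq ?_)
    rw [integral_add' (((hkl.add hqi).sub hpi).const_mul (2 * c)⁻¹) ((hpi.add hqi).const_mul c),
      integral_const_mul, integral_const_mul]
    simp only [Pi.add_apply, Pi.sub_apply]
    have e1 : ∫ x, (p x * (Real.log (p x) - Real.log (q x)) + q x - p x) ∂ν = D + 1 - 1 := by
      rw [integral_sub (f := fun x => p x * (Real.log (p x) - Real.log (q x)) + q x)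
        (hkl.add hqi) hpi, integral_add hkl hqi, hp1, hq1]
    have e2 : ∫ x, (p x + q x) ∂ν = 1 + 1 := by rw [integral_add hpi hqi, hp1, hq1]
    rw [e1, e2]
    ring
  refine le_of_forall_pos_le_add fun ε hε => ?_
  set s := √D
  have hs : 0 ≤ s := Real.sqrt_nonneg _
  have hs2 : D = s ^ 2 := (Real.sq_sqrt hD0).symm
  -- The optimal parameter is `s / 2`; the `ε` keeps it positive when the divergence vanishes.
  have h1 := key ((s + ε) / 2) (by positivity)
  have h2 : (2 * ((s + ε) / 2))⁻¹ * D ≤ s := by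
    rw [hs2, inv_mul_le_iff₀ (by positivity)]
    nlinarith
  linarith

end Hellinger

/-! ### Return differences, visitation distributions and likelihood gaps. -/

section Performance

variable {S A : Type*} [MeasurableSpace S] [MeasurableSpace A] {ref : Measure A}

theorem integrable_of_abs_le {X : Type*} [MeasurableSpace X] {μ : Measure X} [IsFiniteMeasure μ]
    {h : X → ℝ} (hm : Measurable h) {C : ℝ} (hC : ∀ x, |h x| ≤ C) : Integrable h μ :=
  Integrable.of_bound hm.aestronglyMeasurable C (Eventually.of_forall hC)

theorem abs_integral_le_of_abs_le {X : Type*} [MeasurableSpace X] {μ : Measure X}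
    [IsProbabilityMeasure μ] {h : X → ℝ} {C : ℝ} (hC : ∀ x, |h x| ≤ C) : |∫ x, h x ∂μ| ≤ C := by
  simpa using norm_integral_le_of_norm_le_const (μ := μ) (f := h) (C := C) (Eventually.of_forall hC)

/-- The `L¹` distance of the action distributions of two policies at a state. -/
noncomputable def policyDist (p q : Policy S ref) (s : S) : ℝ :=
  ∫ a, |p.dens s a - q.dens s a| ∂ref

theorem measurable_ofReal_dens (p : Policy S ref) :
    Measurable fun x : S × A => ENNReal.ofReal (p.dens x.1 x.2) :=
  p.measurable_dens.ennreal_ofReal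

theorem policyDist_nonneg (p q : Policy S ref) (s : S) : 0 ≤ policyDist p q s :=
  integral_nonneg fun _ => abs_nonneg _

theorem measurable_abs_dens_sub (p q : Policy S ref) :
    Measurable fun x : S × A => |p.dens x.1 x.2 - q.dens x.1 x.2| :=
  (p.measurable_dens.sub q.measurable_dens).abs

theorem integrable_dens_section (p : Policy S ref) (s : S) : Integrable (p.dens s) ref := by
  refine ⟨(p.measurable_dens.comp measurable_prodMk_left).aestronglyMeasurable, ?_⟩
  rw [hasFiniteIntegral_iff_ofReal (Eventually.of_forall fun a => p.dens_nonneg s a),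
    p.lintegral_dens s]
  exact ENNReal.one_lt_top

theorem integral_dens_section (p : Policy S ref) (s : S) : ∫ a, p.dens s a ∂ref = 1 := by
  rw [integral_eq_lintegral_of_nonneg_ae (Eventually.of_forall fun a => p.dens_nonneg s a)
    (integrable_dens_section p s).aestronglyMeasurable, p.lintegral_dens s, ENNReal.toReal_one]

theorem policyDist_le_two (p q : Policy S ref) (s : S) : policyDist p q s ≤ 2 := by
  have hp := integrable_dens_section p s
  have hq := integrable_dens_section q s
  calc policyDist p q s ≤ ∫ a, (p.dens s a + q.dens s a) ∂ref := by
        refine integral_mono (hp.sub hq).abs (hp.add hq) fun a => ?_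
        have h := abs_sub (p.dens s a) (q.dens s a)
        rwa [abs_of_nonneg (p.dens_nonneg s a), abs_of_nonneg (q.dens_nonneg s a)] at h
    _ = 2 := by
        rw [integral_add hp hq, integral_dens_section, integral_dens_section]
        norm_num

theorem measurable_log_dens (p : Policy S ref) :
    Measurable fun x : S × A => Real.log (p.dens x.1 x.2) :=
  Real.measurable_log.comp p.measurable_dens

theorem integrable_log_dens {p : Policy S ref} {L : ℝ} (hp : ∀ s a, |Real.log (p.dens s a)| ≤ L) (ρ : Measure (S × A))
    [IsFiniteMeasure ρ] : Integrable (fun x : S × A => Real.log (p.dens x.1 x.2)) ρ :=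
  integrable_of_abs_le (measurable_log_dens p) fun x => hp x.1 x.2

variable [SFinite ref]

instance (m : MDP S A) : IsMarkovKernel m.trans := m.markov

instance (m : MDP S A) : IsProbabilityMeasure m.init := m.prob_init

instance isProbabilityMeasure_stateLaw (m : MDP S A) (p : Policy S ref) (t : ℕ) :
    IsProbabilityMeasure (stateLaw m p t) := by
  induction t with
  | zero => exact m.prob_init
  | succ t ih =>
    rw [stateLaw]
    infer_instance

theorem hasSum_visitation_weights (m : MDP S A) :
    HasSum (fun t : ℕ => (1 - m.γ) * m.γ ^ t) 1 := by
  have h := (hasSum_geometric_of_lt_one m.γ_nonneg m.γ_lt_one).mul_left (1 - m.γ)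
  rwa [mul_inv_cancel₀ (by linarith [m.γ_lt_one])] at h

theorem visitation_weight_nonneg (m : MDP S A) (t : ℕ) : 0 ≤ (1 - m.γ) * m.γ ^ t :=
  mul_nonneg (by linarith [m.γ_lt_one]) (pow_nonneg m.γ_nonneg t)

instance isProbabilityMeasure_visitation (m : MDP S A) (p : Policy S ref) :
    IsProbabilityMeasure (visitation m p) := by
  constructor
  rw [visitation, Measure.sum_apply _ MeasurableSet.univ]
  simp only [Measure.smul_apply, measure_univ, smul_eq_mul, mul_one]
  rw [← ENNReal.ofReal_tsum_of_nonneg (visitation_weight_nonneg m)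
    (hasSum_visitation_weights m).summable, (hasSum_visitation_weights m).tsum_eq,
    ENNReal.ofReal_one]

instance isProbabilityMeasure_stateActionLaw (m : MDP S A) (p : Policy S ref) :
    IsProbabilityMeasure (stateActionLaw m p) := by
  rw [stateActionLaw]
  infer_instance

/-- Puts the state-action laws of all policies over the same state law on one reference measure, so
that they can be compared through densities. -/
theorem compProd_policy_eq_withDensity (μ : Measure S) [SFinite μ] (p : Policy S ref) :
    μ ⊗ₘ p.kernel = (μ.prod ref).withDensity fun x => ENNReal.ofReal (p.dens x.1 x.2) := by
  have : IsSFiniteKernel (Kernel.withDensity (Kernel.const S ref)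
      fun s a => ENNReal.ofReal (p.dens s a)) :=
    inferInstanceAs (IsSFiniteKernel p.kernel)
  rw [Policy.kernel, Measure.compProd_withDensity p.measurable_dens.ennreal_ofReal,
    Measure.compProd_const]

theorem integral_compProd_policy (μ : Measure S) [SFinite μ] (p : Policy S ref) (h : S × A → ℝ) :
    ∫ x, h x ∂(μ ⊗ₘ p.kernel) = ∫ x, p.dens x.1 x.2 * h x ∂(μ.prod ref) := by
  rw [compProd_policy_eq_withDensity, integral_withDensity_eq_integral_toReal_smul
    (measurable_ofReal_dens p) (by simp)]
  simp [ENNReal.toReal_ofReal (p.dens_nonneg _ _)]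

theorem integrable_compProd_policy_iff (μ : Measure S) [SFinite μ] (p : Policy S ref)
    (h : S × A → ℝ) :
    Integrable h (μ ⊗ₘ p.kernel)
      ↔ Integrable (fun x => p.dens x.1 x.2 * h x) (μ.prod ref) := by
  rw [compProd_policy_eq_withDensity, integrable_withDensity_iff_integrable_smul'
    (measurable_ofReal_dens p) (by simp)]
  simp [ENNReal.toReal_ofReal (p.dens_nonneg _ _)]

theorem integrable_dens (μ : Measure S) [IsProbabilityMeasure μ] (p : Policy S ref) :
    Integrable (fun x : S × A => p.dens x.1 x.2) (μ.prod ref) := by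
  have := (integrable_compProd_policy_iff μ p fun _ => 1).1 (integrable_const _)
  simpa using this

theorem integral_dens (μ : Measure S) [IsProbabilityMeasure μ] (p : Policy S ref) :
    ∫ x, p.dens x.1 x.2 ∂(μ.prod ref) = 1 := by
  have := integral_compProd_policy μ p fun _ => 1
  simpa using this.symm

theorem measurable_policyDist (p q : Policy S ref) : Measurable (policyDist p q) :=
  ((measurable_abs_dens_sub p q).stronglyMeasurable.integral_prod_right').measurable

theorem integrable_policyDist (μ : Measure S) [IsFiniteMeasure μ] (p q : Policy S ref) :
    Integrable (policyDist p q) μ :=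
  Integrable.of_bound (measurable_policyDist p q).aestronglyMeasurable 2
    (Eventually.of_forall fun s => by
      rw [Real.norm_eq_abs, abs_of_nonneg (policyDist_nonneg p q s)]
      exact policyDist_le_two p q s)

theorem integral_policyDist (μ : Measure S) [IsProbabilityMeasure μ] (p q : Policy S ref) :
    ∫ s, policyDist p q s ∂μ = ∫ x, |p.dens x.1 x.2 - q.dens x.1 x.2| ∂(μ.prod ref) :=
  (integral_prod _ ((integrable_dens μ p).sub (integrable_dens μ q)).abs).symm

/-- Changing the policy for one action changes expectations by at most its `L¹` distance. -/
theorem abs_integral_sub_policy_le (μ : Measure S) [IsProbabilityMeasure μ] (p q : Policy S ref)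
    {h : S × A → ℝ} (hm : Measurable h) {C : ℝ} (hC : ∀ x, |h x| ≤ C) :
    |∫ x, h x ∂(μ ⊗ₘ p.kernel) - ∫ x, h x ∂(μ ⊗ₘ q.kernel)| ≤ C * ∫ s, policyDist p q s ∂μ := by
  have hp := (integrable_compProd_policy_iff μ p h).1 (integrable_of_abs_le hm hC)
  have hq := (integrable_compProd_policy_iff μ q h).1 (integrable_of_abs_le hm hC)
  rw [integral_compProd_policy, integral_compProd_policy, ← integral_sub hp hq,
    integral_policyDist, ← integral_const_mul]
  refine (abs_integral_le_integral_abs).trans (integral_mono (hp.sub hq).abs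
    (((integrable_dens μ p).sub (integrable_dens μ q)).abs.const_mul C) fun x => ?_)
  rw [← sub_mul, abs_mul, mul_comm]
  exact mul_le_mul_of_nonneg_right (hC x) (abs_nonneg _)

theorem integral_comp_kernel {X Y : Type*} [MeasurableSpace X] [MeasurableSpace Y]
    (κ : Kernel X Y) [IsMarkovKernel κ] (μ : Measure X) [IsFiniteMeasure μ] {h : Y → ℝ}
    (hm : Measurable h) {C : ℝ} (hC : ∀ y, |h y| ≤ C) :
    ∫ y, h y ∂(κ ∘ₘ μ) = ∫ x, ∫ y, h y ∂(κ x) ∂μ := by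
  rw [← Measure.snd_compProd, Measure.snd, integral_map measurable_snd.aemeasurable
    hm.aestronglyMeasurable, Measure.integral_compProd
    (f := fun x : X × Y => h x.2) (integrable_of_abs_le (hm.comp measurable_snd) fun _ => hC _)]

/-- Simulation lemma: the laws of `(s_t, a_t)` under two policies differ by at most the accumulated
expected `L¹` distance of the policies along the trajectories of the first one. -/
theorem abs_integral_sub_stateLaw_le (m : MDP S A) (p q : Policy S ref) (t : ℕ) :
    ∀ {h : S × A → ℝ}, Measurable h → ∀ {C : ℝ}, (∀ x, |h x| ≤ C) →
    |∫ x, h x ∂(stateLaw m p t ⊗ₘ p.kernel) - ∫ x, h x ∂(stateLaw m q t ⊗ₘ q.kernel)|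
      ≤ C * ∑ k ∈ Finset.range (t + 1), ∫ s, policyDist p q s ∂(stateLaw m p k) := by
  induction t with
  | zero =>
    intro h hm C hC
    rw [zero_add, Finset.sum_range_one]
    exact abs_integral_sub_policy_le m.init p q hm hC
  | succ t ih =>
    intro h hm C hC
    -- Averaging `h` over the last action under `q` and then over the last transition gives `h'`,
    -- with the same bound `C`. The induction hypothesis for `h'` compares the state laws, and only
    -- the last action choice remains.
    let k : S → ℝ := fun s => ∫ a, h (s, a) ∂(q.kernel s)
    have hk : Measurable k := (hm.stronglyMeasurable.integral_kernel_prod_right').measurable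
    have hkC : ∀ s, |k s| ≤ C := fun s => abs_integral_le_of_abs_le fun a => hC _
    let h' : S × A → ℝ := fun x => ∫ s, k s ∂(m.trans x)
    have hm' : Measurable h' := (hk.stronglyMeasurable.integral_kernel).measurable
    have hC' : ∀ x, |h' x| ≤ C := fun x => abs_integral_le_of_abs_le hkC
    have h1 := abs_integral_sub_policy_le (stateLaw m p (t + 1)) p q hm hC
    have h2 := ih hm' hC'
    have e : ∀ r : Policy S ref, ∫ x, h x ∂(stateLaw m r (t + 1) ⊗ₘ q.kernel)
        = ∫ x, h' x ∂(stateLaw m r t ⊗ₘ r.kernel) := by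
      intro r
      rw [Measure.integral_compProd (integrable_of_abs_le hm hC)]
      exact integral_comp_kernel m.trans (stateLaw m r t ⊗ₘ r.kernel) hk hkC
    rw [e p] at h1
    rw [e q, Finset.sum_range_succ, mul_add]
    refine (abs_sub_le _ (∫ x, h' x ∂(stateLaw m p t ⊗ₘ p.kernel)) _).trans ?_
    linarith

theorem integral_visitation (m : MDP S A) (p : Policy S ref) {g : S → ℝ}
    (hg : Integrable g (visitation m p)) :
    HasSum (fun t : ℕ => (1 - m.γ) * m.γ ^ t * ∫ s, g s ∂(stateLaw m p t))
      (∫ s, g s ∂(visitation m p)) := by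
  have h := hasSum_integral_measure (μ := fun t : ℕ =>
    ENNReal.ofReal ((1 - m.γ) * m.γ ^ t) • stateLaw m p t) hg
  simp only [integral_smul_measure, ENNReal.toReal_ofReal (visitation_weight_nonneg m _),
    smul_eq_mul] at h
  exact h

/-- The return of a policy is close to that of a policy which is close in `L¹` distance on its own
visitation distribution. -/
theorem abs_expReturn_sub_le (m : MDP S A) {R : ℝ} (hR : ∀ s a, |m.reward s a| ≤ R)
    (p q : Policy S ref) :
    |expReturn m p - expReturn m q|
      ≤ R / (1 - m.γ) ^ 2 * ∫ s, policyDist p q s ∂(visitation m p) := by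
  have hγ0 := m.γ_nonneg
  have hγ1 : 0 < 1 - m.γ := by linarith [m.γ_lt_one]
  let e : ℕ → ℝ := fun t => ∫ s, policyDist p q s ∂(stateLaw m p t)
  have hr : Measurable fun x : S × A => m.reward x.1 x.2 := m.measurable_reward
  have hrew : ∀ r : Policy S ref,
      Summable fun t : ℕ => m.γ ^ t * ∫ x, m.reward x.1 x.2 ∂(stateLaw m r t ⊗ₘ r.kernel) := by
    intro r
    refine Summable.of_norm_bounded
      ((summable_geometric_of_lt_one m.γ_nonneg m.γ_lt_one).mul_right R) fun t => ?_
    rw [norm_mul, norm_pow, Real.norm_eq_abs, abs_of_nonneg hγ0]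
    exact mul_le_mul_of_nonneg_left (abs_integral_le_of_abs_le fun x => hR x.1 x.2)
      (pow_nonneg hγ0 t)
  have hvis := integral_visitation m p (integrable_policyDist (visitation m p) p q)
  have he : HasSum (fun t => m.γ ^ t * e t)
      ((1 - m.γ)⁻¹ * ∫ s, policyDist p q s ∂(visitation m p)) := by
    refine (hvis.mul_left (1 - m.γ)⁻¹).congr_fun fun t => ?_
    rw [← mul_assoc, ← mul_assoc, inv_mul_cancel₀ hγ1.ne', one_mul]
  have hgeo := hasSum_geometric_of_lt_one m.γ_nonneg m.γ_lt_one
  -- Discounted partial sums form a Cauchy product with the geometric series. One factor `(1 - γ)⁻¹`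
  -- comes from this accumulation, the other from the normalization of the visitation distribution.
  have hcauchy : HasSum (fun t => ∑ k ∈ Finset.range (t + 1), m.γ ^ k * e k * m.γ ^ (t - k))
      ((1 - m.γ)⁻¹ * (∫ s, policyDist p q s ∂(visitation m p)) * (1 - m.γ)⁻¹) := by
    have h := hasSum_sum_range_mul_of_summable_norm (f := fun t => m.γ ^ t * e t)
      (g := fun t => m.γ ^ t) he.summable.norm hgeo.summable.norm
    rwa [he.tsum_eq, hgeo.tsum_eq] at h
  have hcauchy' : HasSum (fun t => R * (m.γ ^ t * ∑ k ∈ Finset.range (t + 1), e k))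
      (R * ((1 - m.γ)⁻¹ * (∫ s, policyDist p q s ∂(visitation m p)) * (1 - m.γ)⁻¹)) := by
    refine (hcauchy.mul_left R).congr_fun fun t => ?_
    rw [Finset.mul_sum]
    congr 1
    refine Finset.sum_congr rfl fun k hk => ?_
    have : m.γ ^ t = m.γ ^ k * m.γ ^ (t - k) := by
      rw [← pow_add, Nat.add_sub_cancel' (Nat.lt_succ_iff.1 (Finset.mem_range.1 hk))]
    rw [this]
    ring
  have hsub := (hrew p).hasSum.sub (hrew q).hasSum
  have hfin : ‖expReturn m p - expReturn m q‖
      ≤ R * ((1 - m.γ)⁻¹ * (∫ s, policyDist p q s ∂(visitation m p)) * (1 - m.γ)⁻¹) := by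
    refine hsub.norm_le_of_bounded hcauchy' fun t => ?_
    rw [← mul_sub, norm_mul, norm_pow, Real.norm_eq_abs, abs_of_nonneg hγ0, mul_left_comm]
    exact mul_le_mul_of_nonneg_left (abs_integral_sub_stateLaw_le m p q t hr fun x => hR x.1 x.2)
      (pow_nonneg hγ0 t)
  rw [Real.norm_eq_abs] at hfin
  refine hfin.trans (le_of_eq ?_)
  field_simp

variable {πb p : Policy S ref} {m : MDP S A} {L : ℝ}

theorem integrable_kl_density
    (hb : Integrable (fun x : S × A => Real.log (πb.dens x.1 x.2)) (stateActionLaw m πb))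
    (hp : ∀ s a, |Real.log (p.dens s a)| ≤ L) :
    Integrable (fun x : S × A => πb.dens x.1 x.2
        * (Real.log (πb.dens x.1 x.2) - Real.log (p.dens x.1 x.2))) ((visitation m πb).prod ref) :=
  (integrable_compProd_policy_iff _ _ _).1 (hb.sub (integrable_log_dens hp (stateActionLaw m πb)))

theorem logLik_sub_logLik
    (hb : Integrable (fun x : S × A => Real.log (πb.dens x.1 x.2)) (stateActionLaw m πb))
    (hp : ∀ s a, |Real.log (p.dens s a)| ≤ L) :
    logLik (stateActionLaw m πb) πb - logLik (stateActionLaw m πb) p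
      = ∫ x, πb.dens x.1 x.2 * (Real.log (πb.dens x.1 x.2) - Real.log (p.dens x.1 x.2))
          ∂((visitation m πb).prod ref) := by
  rw [logLik, logLik, ← integral_sub hb (integrable_log_dens hp _)]
  exact integral_compProd_policy _ _ _

/-- Gibbs' inequality: no policy has a larger expected log-likelihood than the behavior policy. -/
theorem logLik_le_logLik_behavior
    (hb : Integrable (fun x : S × A => Real.log (πb.dens x.1 x.2)) (stateActionLaw m πb))
    (hpos : ∀ s a, 0 < p.dens s a) (hp : ∀ s a, |Real.log (p.dens s a)| ≤ L) :
    logLik (stateActionLaw m πb) p ≤ logLik (stateActionLaw m πb) πb := by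
  rw [← sub_nonneg, logLik_sub_logLik hb hp]
  exact integral_mul_log_sub_log_nonneg (fun x => πb.dens_nonneg _ _) (fun x => hpos _ _)
    (integrable_dens _ _) (integrable_dens _ _) ((integral_dens _ _).trans (integral_dens _ _).symm)
    (integrable_kl_density hb hp)

/-- The loss of return with respect to the behavior policy is controlled by the loss of expected
log-likelihood. -/
theorem expReturn_ge_of_logLik {R : ℝ} (hR : ∀ s a, |m.reward s a| ≤ R) (hR0 : 0 ≤ R)
    (hb : Integrable (fun x : S × A => Real.log (πb.dens x.1 x.2)) (stateActionLaw m πb))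
    (hpos : ∀ s a, 0 < p.dens s a) (hp : ∀ s a, |Real.log (p.dens s a)| ≤ L) :
    expReturn m πb - R / (1 - m.γ) ^ 2
        * (2 * √(logLik (stateActionLaw m πb) πb - logLik (stateActionLaw m πb) p))
      ≤ expReturn m p := by
  have h1 := abs_expReturn_sub_le m hR πb p
  have h2 := integral_abs_sub_le_sqrt (ν := (visitation m πb).prod ref)
    (fun x => πb.dens_nonneg x.1 x.2) (fun x => hpos x.1 x.2)
    (integrable_dens _ _) (integrable_dens _ _) (integral_dens _ _) (integral_dens _ _)
    (integrable_kl_density hb hp)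
  rw [← logLik_sub_logLik hb hp, ← integral_policyDist] at h2
  have h3 : 0 ≤ R / (1 - m.γ) ^ 2 := by positivity
  have h4 := mul_le_mul_of_nonneg_left h2 h3
  have h5 := (abs_le.1 h1).2
  linarith

end Performance

/-! ### Uniform convergence of empirical log-likelihoods. -/

section Concentration

variable {S A Φ Ω : Type*} [MeasurableSpace S] [MeasurableSpace A] [MeasurableSpace Ω]
  {ref : Measure A} {pol : Φ → Policy S ref} {L : ℝ}

/-- Thresholds are free, so one function already shatters one point: `y` includes it and `y + 1`
excludes it. This supplies the `1 ≤ V` used in chaining. -/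
theorem one_le_of_vcDimLE_logLikClass [Nonempty Φ] [Nonempty (S × A)] {V : ℕ}
    (hV : VCDimLE (logLikClass pol) V) : 1 ≤ V := by
  classical
  obtain ⟨φ⟩ := ‹Nonempty Φ›
  obtain ⟨z⟩ := ‹Nonempty (S × A)›
  set y := Real.log ((pol φ).dens z.1 z.2) with hy
  refine hV {z} fun U _ => ?_
  refine ⟨_, ⟨φ, rfl⟩, if z ∈ U then y else y + 1, fun w hw => ?_⟩
  rw [Finset.mem_singleton] at hw
  subst hw
  by_cases h : w ∈ U <;> simp [h, ← hy]

theorem tendsto_log_dens (hpos : ∀ φ s a, 0 < (pol φ).dens s a) {φ : Φ} {u : ℕ → Φ}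
    (hu : ∀ s a, Tendsto (fun k => (pol (u k)).dens s a) atTop (𝓝 ((pol φ).dens s a)))
    (s : S) (a : A) :
    Tendsto (fun k => Real.log ((pol (u k)).dens s a)) atTop
      (𝓝 (Real.log ((pol φ).dens s a))) :=
  (hu s a).log (hpos φ s a).ne'

theorem tendsto_logLik (hpos : ∀ φ s a, 0 < (pol φ).dens s a)
    (hL : ∀ φ s a, |Real.log ((pol φ).dens s a)| ≤ L) (ρ : Measure (S × A)) [IsFiniteMeasure ρ]
    {φ : Φ} {u : ℕ → Φ}
    (hu : ∀ s a, Tendsto (fun k => (pol (u k)).dens s a) atTop (𝓝 ((pol φ).dens s a))) :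
    Tendsto (fun k => logLik ρ (pol (u k))) atTop (𝓝 (logLik ρ (pol φ))) :=
  tendsto_integral_of_dominated_convergence (fun _ => L)
    (fun k => (measurable_log_dens (pol (u k))).aestronglyMeasurable) (integrable_const L)
    (fun k => Eventually.of_forall fun x => hL (u k) x.1 x.2)
    (Eventually.of_forall fun x => tendsto_log_dens hpos hu x.1 x.2)

/-- Log-likelihoods depend only on the state-action pair; projecting away the next state keeps an
independent sample. -/
theorem map_fst_sample_eq_pi {X Y : Type*} [MeasurableSpace X] [MeasurableSpace Y]
    {P : Measure Ω} [IsProbabilityMeasure P] {μ : Measure (X × Y)} {n : ℕ}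
    {D : Fin n → Ω → X × Y} (hlaw : ∀ i, HasLaw (D i) μ P) (hind : iIndepFun D P) :
    AEMeasurable (fun ω i => (D i ω).1) P ∧
      P.map (fun ω i => (D i ω).1) = Measure.pi fun _ : Fin n => μ.fst := by
  have hm : ∀ i, AEMeasurable (fun ω => (D i ω).1) P := fun i =>
    measurable_fst.comp_aemeasurable (hlaw i).aemeasurable
  refine ⟨aemeasurable_pi_lambda _ hm, ?_⟩
  have hi : iIndepFun (fun i ω => (D i ω).1) P :=
    hind.comp (fun _ => Prod.fst) fun _ => measurable_fst
  rw [(iIndepFun_iff_map_fun_eq_pi_map hm).1 hi]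
  congr 1
  ext1 i
  rw [Measure.fst, ← (hlaw i).map_eq,
    AEMeasurable.map_map_of_aemeasurable measurable_fst.aemeasurable (hlaw i).aemeasurable]
  rfl

/-- Uniform convergence of empirical log-likelihoods over a policy class of bounded complexity. -/
theorem exists_event_abs_empLogLik_sub_logLik_le [Nonempty Φ] (hsep : PointwiseSeparable pol)
    (hL0 : 0 < L) (hpos : ∀ φ s a, 0 < (pol φ).dens s a)
    (hL : ∀ φ s a, |Real.log ((pol φ).dens s a)| ≤ L)
    {V : ℕ} (hV1 : 1 ≤ V) (hV : VCDimLE (logLikClass pol) V)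
    {P : Measure Ω} [IsProbabilityMeasure P] {μ : Measure ((S × A) × S)} [IsProbabilityMeasure μ]
    {n : ℕ} (hn : 0 < n) {D : Fin n → Ω → (S × A) × S}
    (hlaw : ∀ i, HasLaw (D i) μ P) (hind : iIndepFun D P)
    {δ : ℝ} (hδ : 0 < δ) (hδ1 : δ < 1) :
    ∃ E : Set Ω, MeasurableSet E ∧ ENNReal.ofReal (1 - δ) ≤ P E ∧ ∀ ω ∈ E, ∀ φ,
      |empLogLik (fun i => D i ω) (pol φ) - logLik μ.fst (pol φ)|
        ≤ 160 * L * √((V - Real.log δ) / n) := by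
  obtain ⟨Φ₀, hcount, hdense⟩ := hsep
  have hne : Φ₀.Nonempty := by
    obtain ⟨φ⟩ := ‹Nonempty Φ›
    obtain ⟨u, hu, -⟩ := hdense φ
    exact ⟨u 0, hu 0⟩
  obtain ⟨e, rfl⟩ := hcount.exists_eq_range hne
  have hn' : (0 : ℝ) < n := by exact_mod_cast hn
  set r := 160 * L * √((V - Real.log δ) / n)
  let f : ℕ → S × A → ℝ := fun k z => Real.log ((pol (e k)).dens z.1 z.2)
  let bad : Set (Fin n → S × A) :=
    {z | ∃ j, n * r < |∑ i, (f j (z i) - ∫ y, f j y ∂μ.fst)|}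
  have hfm : ∀ j, Measurable (f j) := fun j => measurable_log_dens _
  have hbadm : MeasurableSet bad := by
    have : bad = ⋃ j, {z | n * r < |∑ i, (f j (z i) - ∫ y, f j y ∂μ.fst)|} := by
      ext z; simp [bad]
    rw [this]
    refine MeasurableSet.iUnion fun j => measurableSet_lt measurable_const ?_
    have := hfm j
    fun_prop
  have hbad : (Measure.pi fun _ : Fin n => μ.fst) bad ≤ ENNReal.ofReal δ :=
    measure_deviation_le hV hV1 hL0 (by rintro _ ⟨φ, rfl⟩ z; exact hL φ z.1 z.2) μ.fst f
      (fun j => ⟨e j, rfl⟩) hfm hn hδ hδ1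
  obtain ⟨hXm, hXlaw⟩ := map_fst_sample_eq_pi hlaw hind
  rw [← hXlaw, Measure.map_apply_of_aemeasurable hXm hbadm] at hbad
  -- The sample is only almost everywhere measurable, so the preimage is enlarged to a measurable
  -- set of equal measure.
  set N := toMeasurable P ((fun ω i => (D i ω).1) ⁻¹' bad)
  have hN : MeasurableSet N := measurableSet_toMeasurable _ _
  refine ⟨Nᶜ, hN.compl, ?_, fun ω hω => ?_⟩
  · rw [prob_compl_eq_one_sub hN, measure_toMeasurable,
      ENNReal.ofReal_sub _ hδ.le, ENNReal.ofReal_one]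
    exact tsub_le_tsub_left hbad 1
  have hdev : ∀ j, |empLogLik (fun i => D i ω) (pol (e j)) - logLik μ.fst (pol (e j))| ≤ r := by
    intro j
    have hnot : ¬ (fun i => (D i ω).1) ∈ bad := fun h => hω (subset_toMeasurable _ _ h)
    have h1 : |∑ i, (f j (D i ω).1 - ∫ y, f j y ∂μ.fst)| ≤ n * r :=
      not_lt.1 fun h => hnot ⟨j, h⟩
    have h2 : empLogLik (fun i => D i ω) (pol (e j)) - logLik μ.fst (pol (e j))
        = (∑ i, (f j (D i ω).1 - ∫ y, f j y ∂μ.fst)) / n := by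
      rw [Finset.sum_sub_distrib, Finset.sum_const, Finset.card_univ, Fintype.card_fin,
        nsmul_eq_mul, sub_div, mul_div_cancel_left₀ _ hn'.ne']
      rfl
    rw [h2, abs_div, abs_of_pos hn', div_le_iff₀ hn']
    linarith
  intro φ
  obtain ⟨u, hu, hlim⟩ := hdense φ
  have hemp : Tendsto (fun k => empLogLik (fun i => D i ω) (pol (u k))) atTop
      (𝓝 (empLogLik (fun i => D i ω) (pol φ))) :=
    (tendsto_finsetSum _ fun i _ => tendsto_log_dens hpos hlim _ _).div_const _
  -- The non-strict bound passes to limits: the empirical average is a finite sum, and the true one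
  -- converges by domination. The event stays the same for all `φ`.
  refine le_of_tendsto (hemp.sub (tendsto_logLik hpos hL μ.fst hlim)).abs
    (Eventually.of_forall fun k => ?_)
  obtain ⟨j, hj⟩ := hu k
  rw [← hj]
  exact hdev j

end Concentration

/-! ### Likelihood guaranteed by the policy update. -/

section PolicyStep

theorem abs_qBar_le {S A Θ : Type*} {M : ℕ} {Q : Θ → S → A → ℝ} {ν : ℝ} (hν : ν ∈ Icc (0 : ℝ) 1)
    {θ : Fin M → Θ} (hM : 0 < M) {B : ℝ} {s : S} {a : A} (hQ : ∀ j, |Q (θ j) s a| ≤ B) :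
    |qBar Q ν θ s a| ≤ B := by
  have : Nonempty (Fin M) := ⟨⟨0, hM⟩⟩
  have hfin : (range fun j => Q (θ j) s a).Finite := Set.finite_range _
  have h0 := fun j => abs_le.1 (hQ j)
  have i1 : -B ≤ ⨅ j, Q (θ j) s a := le_ciInf fun j => (h0 j).1
  have i2 : (⨅ j, Q (θ j) s a) ≤ B := (ciInf_le hfin.bddBelow ⟨0, hM⟩).trans (h0 _).2
  have s1 : -B ≤ ⨆ j, Q (θ j) s a := (h0 ⟨0, hM⟩).1.trans (le_ciSup hfin.bddAbove ⟨0, hM⟩)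
  have s2 : (⨆ j, Q (θ j) s a) ≤ B := ciSup_le fun j => (h0 j).2
  obtain ⟨ν0, ν1⟩ := hν
  rw [qBar, abs_le]
  constructor <;> nlinarith

variable {S A Φ : Type*} [MeasurableSpace S] [MeasurableSpace A] {ref : Measure A} [SFinite ref]
  {n : ℕ}

/-- A maximizer of the policy objective has an empirical log-likelihood within `2 B / lam` of the
best one. -/
theorem empLogLik_le_of_isMaxOn {pol : Φ → Policy S ref} {Qb : S → A → ℝ} {B lam : ℝ}
    (hQb : ∀ s a, |Qb s a| ≤ B) (hlam : 0 < lam) (hn : 0 < n) {D : Fin n → (S × A) × S} {φ : Φ}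
    (hmax : IsMaxOn (fun φ => policyObjective Qb lam D (pol φ)) univ φ) (ψ : Φ) :
    empLogLik D (pol ψ) ≤ empLogLik D (pol φ) + 2 * B / lam := by
  have hn' : (0 : ℝ) < n := by exact_mod_cast hn
  have h := hmax (mem_univ ψ)
  simp only [mem_ofPred_eq, policyObjective, Finset.sum_add_distrib, ← Finset.mul_sum] at h
  -- Two value sums differ by at most `2 * n * B`; dividing by `n * lam` gives the slack.
  have hb : ∀ φ, |∑ i, ∫ a, Qb (D i).1.1 a ∂((pol φ).kernel (D i).1.1)| ≤ n * B := fun φ => by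
    have := abs_sum_le_card_mul (fun i => ∫ a, Qb (D i).1.1 a ∂((pol φ).kernel (D i).1.1))
      fun i => abs_integral_le_of_abs_le fun a => hQb _ a
    simpa using this
  have h1 := (abs_le.1 (hb ψ)).1
  have h2 := (abs_le.1 (hb φ)).2
  rw [empLogLik, empLogLik, ← sub_le_iff_le_add', ← sub_div, div_le_div_iff₀ hn' hlam]
  linarith

end PolicyStep

/-! ### The constant `cLambda` and the final numerical bound. -/

section LikelihoodLevel

variable {S A Φ : Type*} [MeasurableSpace S] [MeasurableSpace A] {ref : Measure A} [SFinite ref]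
  {m : MDP S A} {πb : Policy S ref} {pol : Φ → Policy S ref} {B L : ℝ}

theorem cLambda_nonneg [Nonempty Φ] (hB : 0 ≤ B)
    (hb : Integrable (fun x : S × A => Real.log (πb.dens x.1 x.2)) (stateActionLaw m πb))
    (hpos : ∀ φ s a, 0 < (pol φ).dens s a) (hL : ∀ φ s a, |Real.log ((pol φ).dens s a)| ≤ L)
    {lam : ℝ} (hlam : 0 < lam) : 0 ≤ cLambda m πb pol B lam := by
  have h1 : (⨆ φ, logLik (stateActionLaw m πb) (pol φ)) ≤ logLik (stateActionLaw m πb) πb :=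
    ciSup_le fun φ => logLik_le_logLik_behavior hb (hpos φ) (hL φ)
  have h2 : 0 ≤ 2 * B / lam := by positivity
  rw [cLambda, likLevel]
  linarith

theorem strictAntiOn_cLambda (hB : 0 < B) : StrictAntiOn (cLambda m πb pol B) (Ioi 0) := by
  intro x hx y _ hxy
  have : 2 * B / y < 2 * B / x := div_lt_div_of_pos_left (by positivity) hx hxy
  simp only [cLambda, likLevel]
  linarith

/-- `320 ≤ 18 ^ 2` lets one factor `18 ^ 2 * (1 + L)` dominate both terms; hence the constant `36 =
2 * 18`. -/
theorem two_mul_sqrt_le {gap C x : ℝ} (hC : 0 ≤ C) (hx : 0 ≤ x) (hL : 0 ≤ L)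
    (h : gap ≤ C + 320 * L * x) : 2 * √gap ≤ 36 * √(1 + L) * √(C + x) := by
  have h1 : gap ≤ 18 ^ 2 * ((1 + L) * (C + x)) := by nlinarith [mul_nonneg hL hx, mul_nonneg hL hC]
  have h2 := Real.sqrt_le_sqrt h1
  rw [Real.sqrt_mul (by norm_num), Real.sqrt_sq (by norm_num), Real.sqrt_mul (by linarith)] at h2
  linarith

end LikelihoodLevel

end CDC

/-! ### Assembly of the performance bound. -/

theorem theorem2 :
    ∃ K : ℝ, 1 ≤ K ∧
    ∀ {S A Φ Θ Ω : Type*} [MeasurableSpace S] [MeasurableSpace A] [MeasurableSpace Ω]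
      [AddCommGroup Θ] [Module ℝ Θ]
      -- environment with bounded rewards
      (m : CDC.MDP S A) (R : ℝ) (_hR : ∀ s a, |m.reward s a| ≤ R)
      -- behavior policy with finite expected log-density
      (ref : Measure A) [SFinite ref] (πb : CDC.Policy S ref)
      (_hπb : Integrable (fun x : S × A => Real.log (πb.dens x.1 x.2)) (CDC.stateActionLaw m πb))
      -- policy class with bounded log-likelihoods and complexity at most `V`
      (pol : Φ → CDC.Policy S ref) (_hsep : CDC.PointwiseSeparable pol)
      (L : ℝ) (_hL : ∀ φ s a, 0 < (pol φ).dens s a ∧ |Real.log ((pol φ).dens s a)| < L)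
      (V : ℕ) (_hV : CDC.VCDimLE (CDC.logLikClass pol) V)
      -- Q-networks
      (Q : Θ → S → A → ℝ) (_hQ : ∀ θ, Measurable (Function.uncurry (Q θ)))
      -- `n` independent transitions generated by the behavior policy
      (P : Measure Ω) [IsProbabilityMeasure P] (n : ℕ) (_hn : 0 < n)
      (D : Fin n → Ω → (S × A) × S) (_hlaw : ∀ i, HasLaw (D i) (CDC.transitionLaw m πb) P)
      (_hind : iIndepFun D P)
      -- CDC run with `T` iterations, with bounded learned Q-networks
      (M N T : ℕ) (_hM : 0 < M) (_hN : 0 < N) (_hT : 0 < T) (h : CDC.Hyper)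
      (c : Ω → CDC.Trace A Θ Φ n M N)
      (_hrun : ∀ᵐ ω ∂P, CDC.IsCDCRun m Q pol h (fun i => D i ω) T (c ω))
      (B : ℝ) (_hB : ∀ᵐ ω ∂P, ∀ t, 1 ≤ t → t ≤ T → ∀ j s a, |Q ((c ω).θ t j) s a| < B)
      (δ : ℝ) (_hδ : 0 < δ) (_hδ1 : δ < 1),
      -- `C_λ` is nonnegative and decreasing in `λ`
      (∀ lam, 0 < lam → 0 ≤ CDC.cLambda m πb pol B lam) ∧
      StrictAntiOn (CDC.cLambda m πb pol B) (Ioi 0) ∧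
      -- with probability at least `1 - δ`, with `r* = K √(1 + L) R`:
      ∃ E : Set Ω, MeasurableSet E ∧ ENNReal.ofReal (1 - δ) ≤ P E ∧ ∀ ω ∈ E,
        CDC.expReturn m (pol ((c ω).φ T)) ≥ CDC.expReturn m πb
          - K * √(1 + L) * R / (1 - m.γ) ^ 2
            * √(CDC.cLambda m πb pol B h.lam + √((V - Real.log δ) / n)) ∧
        -- the same with the likelihood level reached by the last policy update
        CDC.expReturn m (pol ((c ω).φ T)) ≥ CDC.expReturn m πb
          - K * √(1 + L) * R / (1 - m.γ) ^ 2
            * √(max 0 (CDC.logLik (CDC.stateActionLaw m πb) πb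
                  - CDC.empLogLik (fun i => D i ω) (pol ((c ω).φ T)))
                + √((V - Real.log δ) / n)) := by
  refine ⟨36, by norm_num, ?_⟩
  intro S A Φ Θ Ω _ _ _ _ _ m R hR ref _ πb hπb pol hsep L hL V hV Q _ P _ n hn D hlaw hind
    M N T hM _ hT h c hrun B hB δ hδ hδ1
  have hposd : ∀ φ s a, 0 < (pol φ).dens s a := fun φ s a => (hL φ s a).1
  have hlog : ∀ φ s a, |Real.log ((pol φ).dens s a)| ≤ L := fun φ s a => (hL φ s a).2.le
  have hgood := hrun.and hB
  -- One good outcome suffices to exhibit a policy and to see that `B` is positive.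
  obtain ⟨ω₀, -, hω₀⟩ := hgood.exists
  have : Nonempty Φ := ⟨(c ω₀).φ 0⟩
  have : Nonempty (S × A) := nonempty_of_isProbabilityMeasure (CDC.stateActionLaw m πb)
  obtain ⟨z⟩ := ‹Nonempty (S × A)›
  have hB0 : 0 < B := (abs_nonneg _).trans_lt (hω₀ T hT le_rfl ⟨0, hM⟩ z.1 z.2)
  have hL0 : 0 < L := (abs_nonneg _).trans_lt (hL ((c ω₀).φ 0) z.1 z.2).2
  have hR0 : 0 ≤ R := (abs_nonneg _).trans (hR z.1 z.2)
  have hCnn := fun lam (hlam : 0 < lam) =>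
    CDC.cLambda_nonneg (m := m) (πb := πb) hB0.le hπb hposd hlog hlam
  refine ⟨hCnn, CDC.strictAntiOn_cLambda hB0, ?_⟩
  have : IsProbabilityMeasure (CDC.transitionLaw m πb) := by
    rw [CDC.transitionLaw]; infer_instance
  have hfst : (CDC.transitionLaw m πb).fst = CDC.stateActionLaw m πb := by
    rw [CDC.transitionLaw, Measure.fst_compProd]
  obtain ⟨E, hEm, hPE, hE⟩ := CDC.exists_event_abs_empLogLik_sub_logLik_le hsep hL0 hposd hlog
    (CDC.one_le_of_vcDimLE_logLikClass hV) hV hn hlaw hind hδ hδ1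
  rw [hfst] at hE
  obtain ⟨G, hG, hGm, hGp⟩ := hgood.exists_measurable_mem
  refine ⟨E ∩ G, hEm.inter hGm, ?_, ?_⟩
  · rwa [measure_inter_conull' (measure_mono_null (sdiff_subset_compl _ _) hG)]
  rintro ω ⟨hωE, hωG⟩
  obtain ⟨hrunω, hBω⟩ := hGp ω hωG
  have hE := hE ω hωE
  set φ := (c ω).φ T with hφ
  set x := √((V - Real.log δ) / n) with hx
  have hx0 : 0 ≤ x := Real.sqrt_nonneg _
  obtain ⟨t, rfl⟩ : ∃ t, T = t + 1 := ⟨T - 1, by omega⟩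
  have hemp := CDC.empLogLik_le_of_isMaxOn (fun s a => CDC.abs_qBar_le h.ν_mem hM fun j =>
    (hBω (t + 1) hT le_rfl j s a).le) h.lam_pos hn (hrunω.policy_step t (by omega))
  rw [← hφ] at hemp
  set Cb := CDC.logLik (CDC.stateActionLaw m πb) πb with hCb
  set emp := CDC.empLogLik (fun i => D i ω) (pol φ) with hempdef
  have hlevel : Cb - emp ≤ CDC.cLambda m πb pol B h.lam + 160 * L * x := by
    have hsup : (⨆ ψ, CDC.logLik (CDC.stateActionLaw m πb) (pol ψ))
        ≤ emp + 2 * B / h.lam + 160 * L * x := ciSup_le fun ψ => by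
      have h1 := (abs_le.1 (hE ψ)).1
      have h2 := hemp ψ
      linarith
    rw [CDC.cLambda, CDC.likLevel]
    linarith
  have hdev := (abs_le.1 (hE φ)).2
  have hLx : 0 ≤ L * x := mul_nonneg hL0.le hx0
  -- The 320 allows two deviations of `160 * L * x`: one for the competitors in `hlevel`, one for
  -- `φ` itself in `hdev`. The empirical version needs only the second.
  have hmain : ∀ C, 0 ≤ C →
      Cb - CDC.logLik (CDC.stateActionLaw m πb) (pol φ) ≤ C + 320 * L * x →
      CDC.expReturn m (pol φ) ≥ CDC.expReturn m πb
        - 36 * √(1 + L) * R / (1 - m.γ) ^ 2 * √(C + x) := by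
    intro C hC hgap
    have h1 := CDC.expReturn_ge_of_logLik hR hR0 hπb (hposd φ) (hlog φ)
    have h2 := CDC.two_mul_sqrt_le hC hx0 hL0.le hgap
    have h3 : 0 ≤ R / (1 - m.γ) ^ 2 := by positivity
    have h4 := mul_le_mul_of_nonneg_left h2 h3
    have h5 : 36 * √(1 + L) * R / (1 - m.γ) ^ 2 * √(C + x)
        = R / (1 - m.γ) ^ 2 * (36 * √(1 + L) * √(C + x)) := by ring
    rw [h5]
    linarith
  refine ⟨hmain _ (hCnn _ h.lam_pos) (by linarith), hmain _ (le_max_left _ _) ?_⟩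
  have := le_max_right 0 (Cb - emp)
  linarith
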